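/- Let $\alpha>0$, $\alpha\neq1$. For probability densities $p,q$ on $\mathbb R^n$ let $h_\alpha(p;q)=\frac{1}{1-\alpha}\ln\int p(x)\,q(x)^{\alpha-1}\,dx$ be the Rényi differential cross-entropy of order $\alpha$. A power spectral density of a stationary real process with autocovariance sequence $(r_k)_{k\ge0}$ is an integrable, almost everywhere nonnegative function $t$ on $[0,2\pi]$ with $r_k=\frac1{2\pi}\int_0^{2\pi}t(\lambda)e^{-ik\lambda}\,d\lambda$ for all $k\ge0$. Let $\{X_j\}_{j\ge1}$ and $\{Y_j\}_{j\ge1}$ be stationary zero-mean real Gaussian processes with $\operatorname{Var}(X_1)\ne0$, with power spectral densities $\tilde f$ and $\tilde g$, and with covariance matrices $\Sigma_{X^n}$ and $\Sigma_{Y^n}$ of $X^n=(X_1,\dots,X_n)$ and $Y^n=(Y_1,\dots,Y_n)$. Suppose that $\tilde h$ is the power spectral density of the stationary zero-mean Gaussian process with covariance matrices $B^n=\Sigma_{Y^n}+(\alpha-1)\Sigma_{X^n}$ (for $\alpha<1$ it is part of the hypothesis that such a process exists). Assume that $\tilde g,\tilde h>0$ almost everywhere and that $\ln\tilde g$ and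 $\ln\tilde h$ are integrable on $[0,2\pi]$. Then $\tilde h=\tilde g+(\alpha-1)\tilde f$ almost everywhere on $[0,2\pi]$, $X^n$ and $Y^n$ have probability densities for every $n$, and the Rényi differential cross-entropy rate exists and is $$\lim_{n\to\infty}\frac1n h_\alpha(X^n;Y^n)=\frac{\ln 2\pi}{2}+\frac{1}{4\pi(1-\alpha)}\int_0^{2\pi}\bigl[(2-\alpha)\ln\tilde g(\lambda)-\ln\tilde h(\lambda)\bigr]\,d\lambda .$$ -/

import Mathlib

open MeasureTheory ProbabilityTheory Filter Topology
open scoped ENNReal Real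

/-- A discrete-time real process is (strictly) stationary: every time shift of it has the same law
as the process itself. -/
def IsStationaryProcess {Ω : Type*} [MeasurableSpace Ω] (X : ℕ → Ω → ℝ) (P : Measure Ω) : Prop :=
  ∀ k : ℕ, IdentDistrib (fun ω (j : ℕ) => X (j + k) ω) (fun ω (j : ℕ) => X j ω) P P

/-- A stationary zero-mean Gaussian process. -/
structure IsStationaryCenteredGaussian {Ω : Type*} [MeasurableSpace Ω]
    (X : ℕ → Ω → ℝ) (P : Measure Ω) : Prop where
  gaussian : IsGaussianProcess X P
  stationary : IsStationaryProcess X P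
  zero_mean : ∀ j : ℕ, ∫ ω, X j ω ∂P = 0

/-- The autocovariance sequence of a stationary process, so that the covariance matrix of the first
`n` variables is the Toeplitz matrix with entries `autocov X P |i - j|`. -/
noncomputable def autocov {Ω : Type*} [MeasurableSpace Ω] (X : ℕ → Ω → ℝ) (P : Measure Ω)
    (k : ℕ) : ℝ :=
  cov[X 0, X k; P]

/-- `f` is the power spectral density of a stationary real process with autocovariance sequence
`r`: it is integrable and nonnegative on a period, with Fourier coefficients `r`.
The Fourier identity is one between complex numbers, hence also makes `f` symmetric
about `π` up to null sets, as the spectral density of a real process is. -/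
structure IsPowerSpectralDensity (r : ℕ → ℝ) (f : ℝ → ℝ) : Prop where
  intervalIntegrable : IntervalIntegrable f volume 0 (2 * π)
  nonneg : ∀ᵐ t ∂(volume.restrict (Set.Ioc 0 (2 * π))), 0 ≤ f t
  fourier : ∀ k : ℕ, (r k : ℂ) =
    1 / (2 * (π : ℂ)) * ∫ t in (0 : ℝ)..(2 * π), (f t : ℂ) * Complex.exp (-(Complex.I * k * t))

/-- The random vector of the first `n` variables of a process. -/
def initialSegment {Ω : Type*} (X : ℕ → Ω → ℝ) (n : ℕ) (ω : Ω) : Fin n → ℝ :=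
  fun i => X i ω

/-- The Rényi differential cross-entropy `(1 / (1 - α)) ln ∫ p(x) q(x) ^ (α - 1) dx` of two
probability densities, with values in the extended reals, so that a divergent integral is not
given a finite value. -/
noncomputable def renyiDiffCrossEntropy {E : Type*} [MeasureSpace E] (α : ℝ) (p q : E → ℝ≥0∞) :
    EReal :=
  ((1 / (1 - α) : ℝ) : EReal) * ENNReal.log (∫⁻ x, p x * q x ^ (α - 1))

/-! For each `n` the cross-entropy has a closed form. With `S`, `T` the covariances of `Xⁿ`, `Yⁿ`, a
congruence `C` taking `T` to `1` and `S` to a diagonal matrix splits the integral into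
one-dimensional Gaussian integrals. The determinant of `S` cancels, leaving only `log det T` and
`log det (T + (α - 1) S)` (`gaussian_renyiDiffCrossEntropy`). Both matrices are Toeplitz, with
symbols `g` and `h`, so after division by `n` the limit is Szegő's theorem,
`IsFourierSeq.tendsto_log_det_toeplitz`.

For Szegő's theorem, the ratio of consecutive Toeplitz determinants is the minimum of `∫ |p|² g`
over polynomials of bounded degree with `p(0) = 1`. As the degree grows it tends to the infimum over
all such `p`, which is `exp (∫ log g)`. The infimum is no smaller by convexity of `exp` and the
bound of `|p(0)|` by the Mahler measure (`exp_integral_log_le_integral`). It is no larger because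
`|exp (q/2)|² = exp (Re q)`: Taylor polynomials of `exp (q/2)` are admissible when `q(0) = 0`, and
real parts of polynomials approximate truncations of `-log g` (`le_exp_integral_log`). Telescoping
and Cesàro means finish.

The relation between `h`, `g` and `f` is uniqueness of Fourier coefficients
(`ae_eq_zero_of_fourier_eq_zero`). -/

/-! ### Cross-entropy of Gaussian vectors in finite dimension. -/

open scoped MatrixOrder Matrix.Norms.L2Operator in
theorem Matrix.PosSemidef.exists_eq_transpose_mul_self {n : ℕ} {S : Matrix (Fin n) (Fin n) ℝ}
    (hS : S.PosSemidef) : ∃ B : Matrix (Fin n) (Fin n) ℝ, S = B.transpose * B := by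
  obtain ⟨B, hB⟩ := CStarAlgebra.nonneg_iff_eq_star_mul_self.mp hS.nonneg
  refine ⟨B, ?_⟩
  rwa [Matrix.star_eq_conjTranspose, Matrix.conjTranspose_eq_transpose_of_trivial] at hB

/-- Two real symmetric matrices, one of them positive definite, are simultaneously
diagonalizable by congruence. -/
theorem exists_congr_one_diagonal {n : ℕ} {S T : Matrix (Fin n) (Fin n) ℝ}
    (hS : S.PosDef) (hT : T.IsHermitian) :
    ∃ (C : Matrix (Fin n) (Fin n) ℝ) (v : Fin n → ℝ), C.det ≠ 0 ∧
      C * S * C.transpose = 1 ∧ C * T * C.transpose = Matrix.diagonal v := by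
  obtain ⟨B, hB⟩ := hS.posSemidef.exists_eq_transpose_mul_self
  have hBdet : IsUnit B.det := by
    have h1 := hS.det_pos.ne'
    rw [hB, Matrix.det_mul, Matrix.det_transpose] at h1
    exact isUnit_iff_ne_zero.2 (left_ne_zero_of_mul h1)
  -- As `S = Bᵀ B`, the inverse transpose of `B` takes `S` to `1`. An orthogonal eigenbasis of `D T
  -- Dᵀ` then diagonalizes `T` and leaves the identity unchanged.
  set D : Matrix (Fin n) (Fin n) ℝ := (B⁻¹).transpose with hD
  have hDT : D.transpose = B⁻¹ := by simp [hD]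
  have h1 : D * S * D.transpose = 1 := by
    rw [hDT, hB, hD, ← Matrix.mul_assoc, ← Matrix.transpose_mul,
      Matrix.mul_nonsing_inv _ hBdet, Matrix.transpose_one, Matrix.one_mul,
      Matrix.mul_nonsing_inv _ hBdet]
  have hM : (D * T * D.transpose).IsHermitian := by
    have := Matrix.isHermitian_mul_mul_conjTranspose D hT
    rwa [Matrix.conjTranspose_eq_transpose_of_trivial] at this
  set U : Matrix (Fin n) (Fin n) ℝ := (hM.eigenvectorUnitary : Matrix (Fin n) (Fin n) ℝ) with hU
  have hUU : U.transpose * U = 1 := by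
    have := Unitary.coe_star_mul_self hM.eigenvectorUnitary
    rwa [Matrix.star_eq_conjTranspose, Matrix.conjTranspose_eq_transpose_of_trivial] at this
  have hsp : D * T * D.transpose = U * Matrix.diagonal hM.eigenvalues * U.transpose := by
    have := hM.spectral_theorem
    rw [Unitary.conjStarAlgAut_apply, Matrix.star_eq_conjTranspose,
      Matrix.conjTranspose_eq_transpose_of_trivial] at this
    exact this
  refine ⟨U.transpose * D, hM.eigenvalues, ?_, ?_, ?_⟩
  · rw [Matrix.det_mul]
    refine mul_ne_zero ?_ ?_
    · have := congrArg Matrix.det hUU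
      rw [Matrix.det_mul, Matrix.det_one] at this
      exact left_ne_zero_of_mul (this ▸ one_ne_zero)
    · have := congrArg Matrix.det h1
      rw [Matrix.det_mul, Matrix.det_one] at this
      exact right_ne_zero_of_mul (this ▸ one_ne_zero) |> fun h => by
        rwa [Matrix.det_transpose] at h
  · calc U.transpose * D * S * (U.transpose * D).transpose
        = U.transpose * (D * S * D.transpose) * U := by
          simp only [Matrix.transpose_mul, Matrix.transpose_transpose, Matrix.mul_assoc]
      _ = 1 := by rw [h1, Matrix.mul_one, hUU]
  · calc U.transpose * D * T * (U.transpose * D).transpose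
        = U.transpose * (D * T * D.transpose) * U := by
          simp only [Matrix.transpose_mul, Matrix.transpose_transpose, Matrix.mul_assoc]
      _ = (U.transpose * U) * Matrix.diagonal hM.eigenvalues * (U.transpose * U) := by
          refine (congrArg (fun M => U.transpose * M * U) hsp).trans ?_
          simp only [Matrix.mul_assoc]
      _ = _ := by rw [hUU, Matrix.one_mul, Matrix.mul_one]

theorem lintegral_fin_prod_eq_prod {n : ℕ} {f : Fin n → ℝ → ℝ≥0∞} (hf : ∀ i, Measurable (f i)) :
    ∫⁻ x : Fin n → ℝ, ∏ i, f i (x i) = ∏ i, ∫⁻ t, f i t := by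
  induction n with
  | zero => simp [volume_pi]
  | succ n ih =>
    rw [← ((volume_preserving_piFinSuccAbove (fun _ : Fin (n + 1) => ℝ) 0).symm).lintegral_comp_emb
      (MeasurableEquiv.measurableEmbedding _)]
    simp_rw [MeasurableEquiv.piFinSuccAbove_symm_apply, Fin.insertNthEquiv,
      Fin.prod_univ_succ, Fin.insertNth_zero, Equiv.coe_fn_mk, Fin.cons_succ, Fin.cons_zero]
    rw [← ih fun i => hf i.succ]
    refine lintegral_prod_mul (μ := (volume : Measure ℝ)) (ν := (volume : Measure (Fin n → ℝ)))
      (f := f 0) (g := fun y : Fin n → ℝ => ∏ i, f i.succ (y i))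
      (hf 0).aemeasurable (Measurable.aemeasurable ?_)
    exact Finset.measurable_prod _ fun i _ => (hf i.succ).comp (measurable_pi_apply i)

theorem pi_gaussianReal_eq_withDensity {n : ℕ} {v : Fin n → NNReal} (hv : ∀ i, v i ≠ 0) :
    Measure.pi (fun i => gaussianReal 0 (v i)) =
      volume.withDensity (fun x : Fin n → ℝ => ∏ i, gaussianPDF 0 (v i) (x i)) := by
  refine Measure.pi_eq fun s hs => ?_
  rw [withDensity_apply _ (MeasurableSet.univ_pi hs), ← lintegral_indicator (.univ_pi hs)]
  have h : ∀ x : Fin n → ℝ, (Set.univ.pi s).indicator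
      (fun x : Fin n → ℝ => ∏ i, gaussianPDF 0 (v i) (x i)) x =
      ∏ i, (s i).indicator (gaussianPDF 0 (v i)) (x i) := by
    intro x
    by_cases hx : x ∈ Set.univ.pi s
    · rw [Set.indicator_of_mem hx]
      exact Finset.prod_congr rfl fun i _ => (Set.indicator_of_mem (hx i trivial) _).symm
    · rw [Set.indicator_of_notMem hx]
      simp only [Set.mem_pi, Set.mem_univ, true_imp_iff, not_forall] at hx
      obtain ⟨i, hi⟩ := hx
      exact (Finset.prod_eq_zero (Finset.mem_univ i) (Set.indicator_of_notMem hi _)).symm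
  simp_rw [h]
  rw [lintegral_fin_prod_eq_prod fun i => (measurable_gaussianPDF _ _).indicator (hs i)]
  refine Finset.prod_congr rfl fun i _ => ?_
  rw [lintegral_indicator (hs i), gaussianReal_of_var_ne_zero _ (hv i), withDensity_apply _ (hs i)]

theorem lintegral_comp_mulVec {n : ℕ} {C : Matrix (Fin n) (Fin n) ℝ} (hC : C.det ≠ 0)
    {F : (Fin n → ℝ) → ℝ≥0∞} (hF : Measurable F) :
    ENNReal.ofReal |C.det| * ∫⁻ x, F (C.mulVec x) = ∫⁻ x, F x := by
  have h := Real.map_matrix_volume_pi_eq_smul_volume_pi hC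
  have h2 : ∫⁻ x, F x ∂(Measure.map (Matrix.toLin' C) volume) = ∫⁻ x, F (C.mulVec x) := by
    rw [lintegral_map hF (by fun_prop)]
    rfl
  rw [← h2, h, lintegral_smul_measure, smul_eq_mul, ← mul_assoc, ← ENNReal.ofReal_mul (abs_nonneg _),
    ← abs_mul, mul_inv_cancel₀ hC]
  simp

/-- The density of a random vector whose linear image has a given density. -/
theorem map_eq_withDensity_of_map_mulVec {Ω : Type*} [MeasurableSpace Ω] {P : Measure Ω} {n : ℕ}
    {Z : Ω → Fin n → ℝ} (hZ : AEMeasurable Z P) {C : Matrix (Fin n) (Fin n) ℝ} (hC : C.det ≠ 0)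
    {φ : (Fin n → ℝ) → ℝ≥0∞} (hφ : Measurable φ)
    (h : P.map (fun ω => C.mulVec (Z ω)) = volume.withDensity φ) :
    P.map Z = volume.withDensity (fun x => ENNReal.ofReal |C.det| * φ (C.mulVec x)) := by
  have hCm : Measurable (fun x : Fin n → ℝ => C.mulVec x) :=
    (Matrix.mulVecLin C).continuous_of_finiteDimensional.measurable
  have hCm' : Measurable (fun x : Fin n → ℝ => C⁻¹.mulVec x) :=
    (Matrix.mulVecLin C⁻¹).continuous_of_finiteDimensional.measurable
  have hinv : ∀ x, C⁻¹.mulVec (C.mulVec x) = x := fun x => by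
    rw [Matrix.mulVec_mulVec, Matrix.nonsing_inv_mul _ (isUnit_iff_ne_zero.2 hC), Matrix.one_mulVec]
  have hZ' : P.map Z = (volume.withDensity φ).map (fun x => C⁻¹.mulVec x) := by
    rw [← h]
    refine Eq.trans ?_ (AEMeasurable.map_map_of_aemeasurable hCm'.aemeasurable
      (hCm.comp_aemeasurable hZ)).symm
    congr 1
    funext ω
    simp [hinv]
  rw [hZ']
  ext s hs
  rw [Measure.map_apply hCm' hs, withDensity_apply _ (hCm' hs), withDensity_apply _ hs,
    ← lintegral_indicator (hCm' hs), ← lintegral_indicator hs,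
    ← lintegral_comp_mulVec hC (hφ.indicator (hCm' hs)),
    ← lintegral_const_mul' _ _ ENNReal.ofReal_ne_top]
  refine lintegral_congr fun x => ?_
  by_cases hx : x ∈ s <;> simp [Set.indicator, hinv, hx]

/-- A centered Gaussian vector with diagonal covariance has independent components. -/
theorem map_eq_pi_gaussianReal {Ω : Type*} [MeasurableSpace Ω] {P : Measure Ω}
    [IsProbabilityMeasure P] {n : ℕ} {W : Ω → Fin n → ℝ} (hW : HasGaussianLaw W P)
    (hmean : ∀ i, ∫ ω, W ω i ∂P = 0) {v : Fin n → ℝ}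
    (hcov : ∀ i j, cov[fun ω => W ω i, fun ω => W ω j; P] = Matrix.diagonal v i j) :
    P.map W = Measure.pi (fun i => gaussianReal 0 (v i).toNNReal) := by
  have hind : iIndepFun (fun i ω => W ω i) P :=
    HasGaussianLaw.iIndepFun_of_covariance_eq_zero hW fun i j hij => by
      rw [hcov, Matrix.diagonal_apply_ne _ hij]
  have hev : ∀ i, HasGaussianLaw (fun ω => W ω i) P := fun i =>
    HasGaussianLaw.eval (X := fun i ω => W ω i) hW i
  refine (iIndepFun.map_fun_eq_pi_map (fun i => (hev i).aemeasurable) hind).trans ?_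
  congr 1
  funext i
  rw [(hev i).map_eq_gaussianReal, hmean i, ← covariance_self (hev i).aemeasurable, hcov i i,
    Matrix.diagonal_apply_eq]

theorem covariance_mulVec {Ω : Type*} [MeasurableSpace Ω] {P : Measure Ω}
    [IsProbabilityMeasure P] {n : ℕ} {Z : Ω → Fin n → ℝ} (hZ : ∀ i, MemLp (fun ω => Z ω i) 2 P)
    {S : Matrix (Fin n) (Fin n) ℝ} (hcov : ∀ i j, cov[fun ω => Z ω i, fun ω => Z ω j; P] = S i j)
    (C : Matrix (Fin n) (Fin n) ℝ) (i j : Fin n) :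
    cov[fun ω => C.mulVec (Z ω) i, fun ω => C.mulVec (Z ω) j; P] =
      (C * S * C.transpose) i j := by
  simp only [Matrix.mulVec, dotProduct]
  rw [covariance_fun_sum_fun_sum (fun k => (hZ k).const_mul _) (fun k => (hZ k).const_mul _)]
  simp only [covariance_const_mul_left, covariance_const_mul_right, hcov, Matrix.mul_apply,
    Matrix.transpose_apply, Finset.sum_mul]
  rw [Finset.sum_comm]
  exact Finset.sum_congr rfl fun k _ => Finset.sum_congr rfl fun l _ => by ring

/-- The density of a centered Gaussian vector in coordinates that diagonalize its covariance. -/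
theorem gaussian_map_eq_withDensity {Ω : Type*} [MeasurableSpace Ω] {P : Measure Ω}
    [IsProbabilityMeasure P] {n : ℕ} {Z : Ω → Fin n → ℝ} (hZ : HasGaussianLaw Z P)
    (hmean : ∀ i, ∫ ω, Z ω i ∂P = 0) {S : Matrix (Fin n) (Fin n) ℝ}
    (hcov : ∀ i j, cov[fun ω => Z ω i, fun ω => Z ω j; P] = S i j)
    {C : Matrix (Fin n) (Fin n) ℝ} (hC : C.det ≠ 0) {v : Fin n → ℝ} (hv : ∀ i, 0 < v i)
    (hCS : C * S * C.transpose = Matrix.diagonal v) :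
    P.map Z = volume.withDensity (fun x => ENNReal.ofReal |C.det| *
      ∏ i, gaussianPDF 0 (v i).toNNReal (C.mulVec x i)) := by
  have hev : ∀ i, HasGaussianLaw (fun ω => Z ω i) P := fun i =>
    HasGaussianLaw.eval (X := fun i ω => Z ω i) hZ i
  refine map_eq_withDensity_of_map_mulVec hZ.aemeasurable hC
    (φ := fun y => ∏ i, gaussianPDF 0 (v i).toNNReal (y i)) ?_ ?_
  · exact Finset.measurable_prod _ fun i _ =>
      (measurable_gaussianPDF _ _).comp (measurable_pi_apply i)
  rw [← pi_gaussianReal_eq_withDensity fun i => (Real.toNNReal_pos.2 (hv i)).ne']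
  refine map_eq_pi_gaussianReal ?_ ?_ ?_
  · exact hZ.map_fun (Matrix.mulVecLin C).toContinuousLinearMap
  · intro i
    simp only [Matrix.mulVec, dotProduct]
    rw [integral_finsetSum _ fun k _ => (hev k).integrable.const_mul _]
    simp [integral_const_mul, hmean]
  · intro i j
    rw [covariance_mulVec (fun i => (hev i).memLp_two) hcov, hCS]

/-- The integrand is a constant times `exp (-b t²)` with `b = (1/a + α - 1) / 2`; `hb` is exactly
the condition `b > 0` for convergence. -/
theorem lintegral_gaussianPDF_mul_rpow {a α : ℝ} (ha : 0 < a) (hb : 0 < 1 + (α - 1) * a) :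
    ∫⁻ t, gaussianPDF 0 a.toNNReal t * gaussianPDF 0 1 t ^ (α - 1) =
      ENNReal.ofReal ((2 * π) ^ ((1 - α) / 2) * (1 + (α - 1) * a) ^ (-(1 / 2) : ℝ)) := by
  have h2π : 0 < 2 * π := by positivity
  set b : ℝ := (1 + (α - 1) * a) / (2 * a) with hbdef
  have hbpos : 0 < b := by positivity
  set K : ℝ := (√(2 * π * a))⁻¹ * (√(2 * π))⁻¹ ^ (α - 1) with hK
  have hKpos : 0 < K := by positivity
  have hpt : ∀ t, gaussianPDF 0 a.toNNReal t * gaussianPDF 0 1 t ^ (α - 1) =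
      ENNReal.ofReal (K * Real.exp (-b * t ^ 2)) := by
    intro t
    rw [gaussianPDF, gaussianPDF, ENNReal.ofReal_rpow_of_pos (gaussianPDFReal_pos _ _ _ one_ne_zero),
      ← ENNReal.ofReal_mul (gaussianPDFReal_nonneg _ _ _)]
    congr 1
    simp only [gaussianPDFReal, Real.coe_toNNReal _ ha.le, NNReal.coe_one, sub_zero, mul_one]
    rw [Real.mul_rpow (by positivity) (Real.exp_pos _).le, ← Real.exp_mul, hK]
    have : Real.exp (-b * t ^ 2) =
        Real.exp (-t ^ 2 / (2 * a)) * Real.exp (-t ^ 2 / 2 * (α - 1)) := by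
      rw [← Real.exp_add]
      congr 1
      rw [hbdef]
      field_simp
      ring
    rw [this]
    ring
  simp_rw [hpt]
  rw [← ofReal_integral_eq_lintegral_ofReal ((integrable_exp_neg_mul_sq hbpos).const_mul K)
    (ae_of_all _ fun t => by positivity), integral_const_mul, integral_gaussian]
  congr 1
  rw [hK, hbdef]
  have e1 : (√(2 * π))⁻¹ ^ (α - 1) = (2 * π) ^ ((1 - α) / 2) := by
    rw [Real.sqrt_eq_rpow, ← Real.rpow_neg h2π.le, ← Real.rpow_mul h2π.le]
    congr 1
    ring
  have e2 : (√(2 * π * a))⁻¹ * √(π / ((1 + (α - 1) * a) / (2 * a))) =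
      (1 + (α - 1) * a) ^ (-(1 / 2) : ℝ) := by
    rw [Real.rpow_neg hb.le, ← Real.sqrt_eq_rpow, ← Real.sqrt_inv, ← Real.sqrt_inv,
      ← Real.sqrt_mul (by positivity)]
    congr 1
    field_simp
  rw [e1, ← e2]
  ring

/-- The integrand carries `|det C| ^ α`. The change of variables absorbs one factor, leaving the
exponent `α - 1`, and the rest is a product of one-dimensional integrals. -/
theorem lintegral_prod_gaussianPDF_mul_rpow {n : ℕ} {α : ℝ} {v : Fin n → ℝ} (hv : ∀ i, 0 < v i)
    (hb : ∀ i, 0 < 1 + (α - 1) * v i) {C : Matrix (Fin n) (Fin n) ℝ} (hC : C.det ≠ 0) :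
    ∫⁻ x, (ENNReal.ofReal |C.det| * ∏ i, gaussianPDF 0 (v i).toNNReal (C.mulVec x i)) *
      (ENNReal.ofReal |C.det| * ∏ i, gaussianPDF 0 1 (C.mulVec x i)) ^ (α - 1) =
    ENNReal.ofReal (|C.det| ^ (α - 1) * ∏ i, ((2 * π) ^ ((1 - α) / 2) *
      (1 + (α - 1) * v i) ^ (-(1 / 2) : ℝ))) := by
  have hd : 0 < |C.det| := abs_pos.2 hC
  have hmeas : ∀ i : Fin n, Measurable fun t : ℝ =>
      gaussianPDF 0 (v i).toNNReal t * gaussianPDF 0 1 t ^ (α - 1) := fun i =>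
    (measurable_gaussianPDF _ _).mul ((measurable_gaussianPDF _ _).pow_const _)
  have hpt : ∀ x : Fin n → ℝ,
      (ENNReal.ofReal |C.det| * ∏ i, gaussianPDF 0 (v i).toNNReal (C.mulVec x i)) *
      (ENNReal.ofReal |C.det| * ∏ i, gaussianPDF 0 1 (C.mulVec x i)) ^ (α - 1) =
      ENNReal.ofReal (|C.det| ^ (α - 1)) * (ENNReal.ofReal |C.det| *
        ∏ i, (gaussianPDF 0 (v i).toNNReal (C.mulVec x i) *
          gaussianPDF 0 1 (C.mulVec x i) ^ (α - 1))) := by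
    intro x
    have hfin : ∏ i, gaussianPDF 0 1 (C.mulVec x i) ≠ ∞ :=
      (ENNReal.prod_lt_top fun i _ => by simp [gaussianPDF]).ne
    rw [ENNReal.mul_rpow_of_ne_top ENNReal.ofReal_ne_top hfin, ENNReal.ofReal_rpow_of_pos hd,
      Finset.prod_mul_distrib, ENNReal.prod_rpow_of_ne_top fun i _ => by simp [gaussianPDF]]
    ring
  simp_rw [hpt]
  rw [lintegral_const_mul' _ _ ENNReal.ofReal_ne_top, lintegral_const_mul' _ _ ENNReal.ofReal_ne_top,
    lintegral_comp_mulVec hC (F := fun y => ∏ i, (gaussianPDF 0 (v i).toNNReal (y i) *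
          gaussianPDF 0 1 (y i) ^ (α - 1)))
      (Finset.measurable_prod _ fun i _ => (hmeas i).comp (measurable_pi_apply i)),
    lintegral_fin_prod_eq_prod hmeas, ENNReal.ofReal_mul (by positivity),
    ENNReal.ofReal_prod_of_nonneg fun i _ => by have := hb i; positivity]
  congr 1
  exact Finset.prod_congr rfl fun i _ => lintegral_gaussianPDF_mul_rpow (hv i) (hb i)

/-- The Rényi differential cross-entropy between centered nondegenerate Gaussian vectors. -/
theorem gaussian_renyiDiffCrossEntropy {Ω Ω' : Type*} [MeasurableSpace Ω] [MeasurableSpace Ω']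
    {P : Measure Ω} {P' : Measure Ω'} [IsProbabilityMeasure P] [IsProbabilityMeasure P'] {n : ℕ}
    {X : Ω → Fin n → ℝ} {Y : Ω' → Fin n → ℝ} (hX : HasGaussianLaw X P) (hY : HasGaussianLaw Y P')
    (hX0 : ∀ i, ∫ ω, X ω i ∂P = 0) (hY0 : ∀ i, ∫ ω, Y ω i ∂P' = 0)
    {S T : Matrix (Fin n) (Fin n) ℝ}
    (hXcov : ∀ i j, cov[fun ω => X ω i, fun ω => X ω j; P] = S i j)
    (hYcov : ∀ i j, cov[fun ω => Y ω i, fun ω => Y ω j; P'] = T i j)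
    (hS : S.PosDef) (hT : T.PosDef) {α : ℝ} (hα : α ≠ 1) (hB : (T + (α - 1) • S).PosDef) :
    HasPDF X P volume ∧ HasPDF Y P' volume ∧
    renyiDiffCrossEntropy α (pdf X P volume) (pdf Y P' volume) =
      ((n * (Real.log (2 * π) / 2) + 1 / (2 * (1 - α)) * ((2 - α) * Real.log T.det -
        Real.log (T + (α - 1) • S).det) : ℝ) : EReal) := by
  obtain ⟨C, v, hC, hCT, hCS⟩ := exists_congr_one_diagonal hT hS.isHermitian
  have hCB : C * (T + (α - 1) • S) * C.transpose =
      Matrix.diagonal fun i => 1 + (α - 1) * v i := by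
    rw [Matrix.mul_add, Matrix.add_mul, hCT, Matrix.mul_smul, Matrix.smul_mul, hCS,
      ← Matrix.diagonal_one, ← Matrix.diagonal_smul, Matrix.diagonal_add]
    rfl
  -- Congruence preserves positive definiteness. For `S` this gives positive variances, for `T + (α
  -- - 1) S` the convergence condition in each coordinate.
  have hcongr : ∀ {M : Matrix (Fin n) (Fin n) ℝ} {w : Fin n → ℝ}, M.PosDef →
      C * M * C.transpose = Matrix.diagonal w → ∀ i, 0 < w i := by
    intro M w hM hw
    have h := hM.mul_mul_conjTranspose_same (B := C)
      (Matrix.vecMul_injective_iff_isUnit.2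
        ((Matrix.isUnit_iff_isUnit_det C).2 (isUnit_iff_ne_zero.2 hC)))
    rw [Matrix.conjTranspose_eq_transpose_of_trivial, hw, Matrix.posDef_diagonal_iff] at h
    exact h
  have hv := hcongr hS hCS
  have hb := hcongr hB hCB
  have hXmap := gaussian_map_eq_withDensity hX hX0 hXcov hC hv hCS
  have hYmap := gaussian_map_eq_withDensity hY hY0 hYcov hC (v := 1) (fun _ => one_pos)
    (by rw [hCT]; exact Matrix.diagonal_one.symm)
  simp only [Pi.one_apply, Real.toNNReal_one] at hYmap
  have hCm : Measurable (fun x : Fin n → ℝ => C.mulVec x) :=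
    (Matrix.mulVecLin C).continuous_of_finiteDimensional.measurable
  have hdm : ∀ w : Fin n → NNReal, AEMeasurable (fun x => ENNReal.ofReal |C.det| *
      ∏ i, gaussianPDF 0 (w i) (C.mulVec x i)) (volume : Measure (Fin n → ℝ)) := fun w =>
    ((Finset.measurable_prod _ fun i _ => (measurable_gaussianPDF _ _).comp
      ((measurable_pi_apply i).comp hCm)).const_mul _).aemeasurable
  have hXpdf := hasPDF_of_map_eq_withDensity hX.aemeasurable _ (hdm _) hXmap
  have hYpdf := hasPDF_of_map_eq_withDensity hY.aemeasurable _ (hdm fun _ => 1) hYmap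
  refine ⟨hXpdf, hYpdf, ?_⟩
  have hXd := (pdf.eq_of_map_eq_withDensity _ (hdm _)).1 hXmap
  have hYd := (pdf.eq_of_map_eq_withDensity _ (hdm fun _ => 1)).1 hYmap
  have hd : 0 < |C.det| := abs_pos.2 hC
  have hint : ∫⁻ x, pdf X P volume x * pdf Y P' volume x ^ (α - 1) =
      ENNReal.ofReal (|C.det| ^ (α - 1) * ∏ i, ((2 * π) ^ ((1 - α) / 2) *
      (1 + (α - 1) * v i) ^ (-(1 / 2) : ℝ))) := by
    rw [← lintegral_prod_gaussianPDF_mul_rpow hv hb hC]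
    refine lintegral_congr_ae ?_
    filter_upwards [hXd, hYd] with x h1 h2
    rw [h1, h2]
  have hbp : ∀ i, 0 < (2 * π) ^ ((1 - α) / 2) * (1 + (α - 1) * v i) ^ (-(1 / 2) : ℝ) := fun i => by
    have := hb i
    positivity
  rw [renyiDiffCrossEntropy, hint, ENNReal.log_ofReal_of_pos
    (mul_pos (by positivity) (Finset.prod_pos fun i _ => hbp i)), ← EReal.coe_mul,
    EReal.coe_eq_coe_iff, Real.log_mul (by positivity) (Finset.prod_pos fun i _ => hbp i).ne',
    Real.log_prod fun i _ => (hbp i).ne', Real.log_rpow hd]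
  have hlog : ∀ i, Real.log ((2 * π) ^ ((1 - α) / 2) * (1 + (α - 1) * v i) ^ (-(1 / 2) : ℝ)) =
      (1 - α) / 2 * Real.log (2 * π) - 1 / 2 * Real.log (1 + (α - 1) * v i) := fun i => by
    have := hb i
    rw [Real.log_mul (by positivity) (by positivity), Real.log_rpow (by positivity),
      Real.log_rpow this]
    ring
  -- Taking determinants in the two congruences eliminates `C` and the `v i` from the formula.
  have hdetT : Real.log T.det = -2 * Real.log |C.det| := by
    have h := congrArg (fun M => Real.log (Matrix.det M)) hCT
    simp only [Matrix.det_mul, Matrix.det_transpose, Matrix.det_one, Real.log_one] at h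
    rw [Real.log_mul (mul_ne_zero hC hT.det_pos.ne') hC, Real.log_mul hC hT.det_pos.ne'] at h
    rw [Real.log_abs]
    linarith
  have hdetB : Real.log (T + (α - 1) • S).det =
      -2 * Real.log |C.det| + ∑ i, Real.log (1 + (α - 1) * v i) := by
    have h := congrArg (fun M => Real.log (Matrix.det M)) hCB
    simp only [Matrix.det_mul, Matrix.det_transpose, Matrix.det_diagonal] at h
    rw [Real.log_mul (mul_ne_zero hC hB.det_pos.ne') hC, Real.log_mul hC hB.det_pos.ne',
      Real.log_prod fun i _ => (hb i).ne'] at h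
    rw [Real.log_abs]
    linarith
  simp only [hlog, Finset.sum_sub_distrib, Finset.sum_const, Finset.card_univ, Fintype.card_fin,
    nsmul_eq_mul, ← Finset.mul_sum]
  rw [hdetT, hdetB]
  have : (1 - α) ≠ 0 := sub_ne_zero.2 hα.symm
  field_simp
  ring

/-! ### Approximation by real parts of polynomials on the circle. -/

/-- On the unit circle `z⁻ᵏ` is the conjugate of `zᵏ`, so negative frequencies are collected in `q`,
on which scalars act through their conjugates. -/
theorem exists_polynomial_of_mem_span_fourier {F : C(AddCircle (2 * π), ℂ)}
    (hF : F ∈ Submodule.span ℂ (Set.range (fourier (T := 2 * π)))) :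
    ∃ p q : Polynomial ℂ, ∀ t : ℝ, F (t : AddCircle (2 * π)) =
      p.eval (circleMap 0 1 t) + (starRingEnd ℂ) (q.eval (circleMap 0 1 t)) := by
  induction hF using Submodule.span_induction with
  | mem F hF =>
    obtain ⟨n, rfl⟩ := hF
    have hz : ∀ t : ℝ, fourier n (t : AddCircle (2 * π)) = Complex.exp (n * (t * Complex.I)) := by
      intro t
      rw [fourier_coe_apply]
      congr 1
      have : (π : ℂ) ≠ 0 := by exact_mod_cast Real.pi_ne_zero
      push_cast
      field_simp
    obtain ⟨k, rfl | rfl⟩ := n.eq_nat_or_neg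
    · refine ⟨Polynomial.X ^ k, 0, fun t => ?_⟩
      rw [hz]
      simp [circleMap, ← Complex.exp_nat_mul]
    · refine ⟨0, Polynomial.X ^ k, fun t => ?_⟩
      rw [hz]
      simp [circleMap, ← Complex.exp_nat_mul, ← Complex.exp_conj]
  | zero => exact ⟨0, 0, fun t => by simp⟩
  | add F G _ _ hF hG =>
    obtain ⟨p, q, h⟩ := hF
    obtain ⟨p', q', h'⟩ := hG
    refine ⟨p + p', q + q', fun t => ?_⟩
    simp only [ContinuousMap.add_apply, h, h', Polynomial.eval_add, map_add]
    ring
  | smul a F _ hF =>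
    obtain ⟨p, q, h⟩ := hF
    refine ⟨Polynomial.C a * p, Polynomial.C ((starRingEnd ℂ) a) * q, fun t => ?_⟩
    simp only [ContinuousMap.smul_apply, h, smul_eq_mul, Polynomial.eval_mul, Polynomial.eval_C,
      map_mul, Complex.conj_conj]
    ring

/-- Continuous functions on the circle are uniformly approximated by real parts of polynomials. -/
theorem exists_polynomial_re_near_continuous (F : C(AddCircle (2 * π), ℝ)) {ε : ℝ} (hε : 0 < ε) :
    ∃ q : Polynomial ℂ, ∀ t : ℝ,
      |F (t : AddCircle (2 * π)) - (q.eval (circleMap 0 1 t)).re| ≤ ε := by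
  have : Fact (0 < 2 * π) := ⟨Real.two_pi_pos⟩
  let G : C(AddCircle (2 * π), ℂ) := ⟨fun x => (F x : ℂ), by fun_prop⟩
  have hG : G ∈ (Submodule.span ℂ (Set.range (fourier (T := 2 * π)))).topologicalClosure := by
    rw [span_fourier_closure_eq_top]
    trivial
  rw [← SetLike.mem_coe, Submodule.topologicalClosure_coe, Metric.mem_closure_iff] at hG
  obtain ⟨H, hH, hd⟩ := hG ε hε
  obtain ⟨p, q, hpq⟩ := exists_polynomial_of_mem_span_fourier hH
  -- A number and its conjugate have the same real part, so `p + conj q` may be replaced by `p + q`.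
  refine ⟨p + q, fun t => ?_⟩
  have h1 : ‖G (t : AddCircle (2 * π)) - H (t : AddCircle (2 * π))‖ ≤ ε := by
    rw [← dist_eq_norm]
    exact (ContinuousMap.dist_apply_le_dist _).trans hd.le
  refine le_trans ?_ h1
  refine le_trans (le_of_eq ?_) (Complex.abs_re_le_norm _)
  rw [hpq]
  simp [G]

/-- The normalized Lebesgue measure on a period. -/
noncomputable def circleProb : Measure ℝ :=
  ENNReal.ofReal (2 * π)⁻¹ • volume.restrict (Set.Ioc 0 (2 * π))

theorem ae_circleProb_iff {p : ℝ → Prop} :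
    (∀ᵐ t ∂circleProb, p t) ↔ ∀ᵐ t ∂(volume.restrict (Set.Ioc 0 (2 * π))), p t := by
  have : ENNReal.ofReal (2 * π)⁻¹ ≠ 0 := by
    rw [Ne, ENNReal.ofReal_eq_zero, not_le]
    positivity
  rw [circleProb, Measure.ae_ennreal_smul_measure_iff this]

instance : IsProbabilityMeasure circleProb where
  measure_univ := by
    have : (0 : ℝ) < 2 * π := by positivity
    rw [circleProb, Measure.smul_apply, Measure.restrict_apply_univ, Real.volume_Ioc, sub_zero,
      smul_eq_mul, ← ENNReal.ofReal_mul (by positivity), inv_mul_cancel₀ this.ne']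
    simp

theorem integral_circleProb {E : Type*} [NormedAddCommGroup E] [NormedSpace ℝ E] (φ : ℝ → E) :
    ∫ t, φ t ∂circleProb = (2 * π)⁻¹ • ∫ t in (0 : ℝ)..(2 * π), φ t := by
  rw [circleProb, integral_smul_measure, intervalIntegral.integral_of_le (by positivity),
    ENNReal.toReal_ofReal (by positivity)]

theorem integrable_circleProb_iff {E : Type*} [NormedAddCommGroup E] {φ : ℝ → E} :
    Integrable φ circleProb ↔ IntervalIntegrable φ volume 0 (2 * π) := by
  have : ENNReal.ofReal (2 * π)⁻¹ ≠ 0 := by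
    rw [Ne, ENNReal.ofReal_eq_zero, not_le]
    positivity
  rw [circleProb, integrable_smul_measure this ENNReal.ofReal_ne_top,
    intervalIntegrable_iff_integrableOn_Ioc_of_le (by positivity), IntegrableOn]

theorem circleProb_compl_Ioc : circleProb (Set.Ioc 0 (2 * π))ᶜ = 0 := by
  simp [circleProb, Measure.restrict_apply]

/-- Bounded measurable functions are approximated in mean by uniformly bounded real parts of
polynomials on the circle. -/
theorem exists_polynomial_re_near_bounded {ρ : Measure ℝ} [IsFiniteMeasure ρ]
    (hρ : ρ (Set.Ioc 0 (2 * π))ᶜ = 0) {u : ℝ → ℝ} (hu : Measurable u) {N : ℝ}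
    (hN : ∀ t, |u t| ≤ N) {ε : ℝ} (hε : 0 < ε) :
    ∃ q : Polynomial ℂ, (∀ t : ℝ, |(q.eval (circleMap 0 1 t)).re| ≤ N + 1) ∧
      ∫ t, |u t - (q.eval (circleMap 0 1 t)).re| ∂ρ ≤ ε := by
  have : Fact (0 < 2 * π) := ⟨Real.two_pi_pos⟩
  set mk : ℝ → AddCircle (2 * π) := fun t => (t : AddCircle (2 * π)) with hmk
  have hmkm : Measurable mk := AddCircle.measurable_mk'
  set U : AddCircle (2 * π) → ℝ := fun x => u (AddCircle.measurableEquivIoc (2 * π) 0 x) with hU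
  have hUm : Measurable U :=
    hu.comp (measurable_subtype_coe.comp (AddCircle.measurableEquivIoc (2 * π) 0).measurable)
  have hUmk : ∀ t ∈ Set.Ioc 0 (2 * π), U (mk t) = u t := by
    intro t ht
    have h := AddCircle.liftIoc_coe_apply (p := 2 * π) (a := 0) (f := u) (x := t) (by simpa using ht)
    exact h
  have hUN : ∀ x, |U x| ≤ N := fun x => hN _
  have : IsFiniteMeasure (ρ.map mk) := by infer_instance
  have hUi : Integrable U (ρ.map mk) :=
    Integrable.of_bound hUm.aestronglyMeasurable N (ae_of_all _ hUN)
  set R : ℝ := ρ.real Set.univ with hR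
  have hR0 : 0 ≤ R := measureReal_nonneg
  obtain ⟨φ, hφ, hφi⟩ := hUi.exists_boundedContinuous_integral_sub_le (half_pos hε)
  have hN0 : 0 ≤ N := (abs_nonneg _).trans (hN 0)
  -- Clamping to `[-N, N]` bounds the approximant and cannot move it away from `U`, whose values
  -- already lie there.
  let ψ : C(AddCircle (2 * π), ℝ) := ⟨fun x => max (-N) (min (φ x) N), by fun_prop⟩
  have hψN : ∀ x, |ψ x| ≤ N := fun x =>
    abs_le.2 ⟨le_max_left _ _, max_le (by linarith) (min_le_right _ _)⟩
  have hψU : ∀ x, |U x - ψ x| ≤ |U x - φ x| := by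
    intro x
    have h1 : U x = max (-N) (min (U x) N) := by
      rw [min_eq_left (abs_le.1 (hUN x)).2, max_eq_right (abs_le.1 (hUN x)).1]
    calc |U x - ψ x| = |max (-N) (min (U x) N) - max (-N) (min (φ x) N)| := by rw [← h1]; rfl
      _ ≤ |min (U x) N - min (φ x) N| := by
        simpa using abs_max_sub_max_le_max (-N) (min (U x) N) (-N) (min (φ x) N)
      _ ≤ |U x - φ x| := by
        simpa using abs_min_sub_min_le_max (U x) N (φ x) N
  -- The `1` yields the uniform bound `N + 1`; the other term makes the total error at most `ε / 2`,
  -- with `R + 1` guarding against zero mass.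
  set δ : ℝ := min 1 (ε / 2 / (R + 1)) with hδ
  have hδ0 : 0 < δ := lt_min one_pos (by positivity)
  obtain ⟨q, hq⟩ := exists_polynomial_re_near_continuous ψ hδ0
  refine ⟨q, fun t => ?_, ?_⟩
  · have h1 := hq t
    have h2 := hψN (t : AddCircle (2 * π))
    have h3 : δ ≤ 1 := min_le_left _ _
    rw [abs_le] at h1 h2 ⊢
    constructor <;> linarith
  have hae : ∀ᵐ t ∂ρ, t ∈ Set.Ioc 0 (2 * π) := by
    rw [ae_iff]
    exact hρ
  have hint : Integrable (fun t => |U (mk t) - φ (mk t)|) ρ :=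
    ((hUi.sub hφi).abs).comp_measurable hmkm
  calc ∫ t, |u t - (q.eval (circleMap 0 1 t)).re| ∂ρ
      ≤ ∫ t, (|U (mk t) - φ (mk t)| + δ) ∂ρ := by
        refine integral_mono_of_nonneg (ae_of_all _ fun t => abs_nonneg _)
          (hint.add (integrable_const δ)) ?_
        filter_upwards [hae] with t ht
        have h1 := hq t
        have h2 := hψU (mk t)
        rw [hUmk t ht] at h2
        have h3 := abs_sub_le (u t) (ψ (mk t)) ((q.eval (circleMap 0 1 t)).re)
        rw [hUmk t ht]
        exact h3.trans (add_le_add h2 h1)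
    _ = ∫ x, ‖U x - φ x‖ ∂(ρ.map mk) + δ * R := by
        rw [integral_add hint (integrable_const δ), integral_const, smul_eq_mul, mul_comm δ]
        exact congrArg (· + R * δ)
          (integral_map hmkm.aemeasurable (hUi.sub hφi).norm.aestronglyMeasurable).symm
    _ ≤ ε / 2 + ε / 2 := by
        refine add_le_add hφ ?_
        calc δ * R ≤ ε / 2 / (R + 1) * (R + 1) := by
              gcongr
              · exact min_le_right _ _
              · linarith
          _ = ε / 2 := by field_simp
    _ = ε := by ring

theorem Polynomial.continuous_eval_circleMap (q : Polynomial ℂ) :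
    Continuous fun t : ℝ => q.eval (circleMap 0 1 t) :=
  q.continuous.comp (continuous_circleMap 0 1)

theorem Polynomial.exists_bound_eval_circleMap (q : Polynomial ℂ) :
    ∃ R : ℝ, ∀ t : ℝ, ‖q.eval (circleMap 0 1 t)‖ ≤ R := by
  obtain ⟨R, hR⟩ := (isCompact_sphere (0 : ℂ) 1).exists_bound_of_continuousOn
    q.continuous.continuousOn
  exact ⟨R, fun t => hR _ (circleMap_mem_sphere 0 zero_le_one t)⟩

/-- An integrable real function whose Fourier coefficients vanish is zero almost everywhere. -/
theorem ae_eq_zero_of_fourier_eq_zero {w : ℝ → ℝ} (hw : Integrable w circleProb)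
    (h : ∀ k : ℕ, ∫ t, (w t : ℂ) * (circleMap 0 1 t) ^ k ∂circleProb = 0) :
    ∀ᵐ t ∂circleProb, w t = 0 := by
  have hpi : ∀ q : Polynomial ℂ,
      Integrable (fun t => (w t : ℂ) * q.eval (circleMap 0 1 t)) circleProb := by
    intro q
    obtain ⟨R, hR⟩ := q.exists_bound_eval_circleMap
    exact hw.ofReal.mul_bdd q.continuous_eval_circleMap.aestronglyMeasurable (ae_of_all _ hR)
  have hp : ∀ q : Polynomial ℂ,
      ∫ t, (w t : ℂ) * q.eval (circleMap 0 1 t) ∂circleProb = 0 := by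
    intro q
    induction q using Polynomial.induction_on' with
    | add p q hp hq =>
      simp only [Polynomial.eval_add, mul_add]
      rw [integral_add (hpi p) (hpi q), hp, hq, add_zero]
    | monomial n a =>
      simp only [Polynomial.eval_monomial]
      simp_rw [mul_left_comm _ a]
      rw [integral_const_mul, h, mul_zero]
  set w' := hw.aestronglyMeasurable.mk w with hw'
  have hw'm : Measurable w' := hw.aestronglyMeasurable.stronglyMeasurable_mk.measurable
  have hww' : w =ᵐ[circleProb] w' := hw.aestronglyMeasurable.ae_eq_mk
  have hw'i : Integrable w' circleProb := hw.congr hww'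
  -- In `∫ |w| = ∫ w · sign w`, the sign is replaced by the real part of a polynomial, against which
  -- the real function `w` integrates to zero. The error of the replacement carries the weight
  -- `|w|`, so the approximation is made for this measure.
  set ρ : Measure ℝ := circleProb.withDensity fun t => ENNReal.ofReal |w' t| with hρ
  have hρfin : IsFiniteMeasure ρ := isFiniteMeasure_withDensity_ofReal hw'i.abs.2
  have hρ0 : ρ (Set.Ioc 0 (2 * π))ᶜ = 0 := withDensity_absolutelyContinuous _ _ circleProb_compl_Ioc
  have hρint : ∀ φ : ℝ → ℝ, ∫ t, φ t ∂ρ = ∫ t, |w' t| * φ t ∂circleProb := by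
    intro φ
    rw [hρ, integral_withDensity_eq_integral_toReal_smul (by fun_prop) (by simp)]
    simp
  set u : ℝ → ℝ := fun t => SignType.sign (w' t) with hu
  have hum : Measurable u := by
    have : u = fun t => if 0 < w' t then 1 else if w' t < 0 then -1 else 0 := by
      funext t
      simp only [hu, sign_apply]
      split_ifs <;> simp
    rw [this]
    exact Measurable.ite (measurableSet_lt measurable_const hw'm) measurable_const
      (Measurable.ite (measurableSet_lt hw'm measurable_const) measurable_const measurable_const)
  have hu1 : ∀ t, |u t| ≤ 1 := by
    intro t
    simp only [hu, sign_apply]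
    split_ifs <;> simp
  have hle : ∀ ε > 0, ∫ t, |w' t| ∂circleProb ≤ ε := by
    intro ε hε
    obtain ⟨q, hqb, hq⟩ := exists_polynomial_re_near_bounded hρ0 hum hu1 hε
    have hz : ∫ t, w' t * (q.eval (circleMap 0 1 t)).re ∂circleProb = 0 := by
      have h1 := congrArg Complex.re (hp q)
      rw [← RCLike.re_eq_complex_re, ← integral_re (hpi q)] at h1
      simp only [RCLike.re_eq_complex_re, Complex.re_ofReal_mul, Complex.zero_re] at h1
      rw [← h1]
      refine integral_congr_ae ?_
      filter_upwards [hww'] with t ht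
      rw [ht]
    have hqi : Integrable (fun t => w' t * (q.eval (circleMap 0 1 t)).re) circleProb :=
      hw'i.mul_bdd (Complex.continuous_re.comp
        q.continuous_eval_circleMap).aestronglyMeasurable (ae_of_all _ hqb)
    have habs : ∀ t, |w' t| = w' t * u t := fun t => by
      rw [hu, mul_comm]
      exact (sign_mul_self _).symm
    calc ∫ t, |w' t| ∂circleProb
        = ∫ t, (|w' t| - w' t * (q.eval (circleMap 0 1 t)).re) ∂circleProb := by
          rw [integral_sub hw'i.abs hqi, hz, sub_zero]
      _ ≤ ∫ t, |w' t| * |u t - (q.eval (circleMap 0 1 t)).re| ∂circleProb := by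
          refine integral_mono (hw'i.abs.sub hqi) ?_ fun t => ?_
          -- Here `3 = 1 + (1 + 1)`: the sign is bounded by `1`, the approximant by `N + 1` with `N
          -- = 1`.
          · refine hw'i.abs.mul_bdd (c := 3) ?_ (ae_of_all _ fun t => ?_)
            · exact ((hum.sub (Complex.continuous_re.comp
                q.continuous_eval_circleMap).measurable).abs).aestronglyMeasurable
            · have h1 := hu1 t
              have h2 := hqb t
              rw [Real.norm_eq_abs, abs_abs]
              rw [abs_le] at h1 h2 ⊢
              constructor <;> linarith
          · show |w' t| - w' t * (q.eval (circleMap 0 1 t)).re ≤ _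
            rw [habs t, ← mul_sub, ← habs t, ← abs_mul]
            exact le_abs_self _
      _ ≤ ε := by rw [← hρint]; exact hq
  have h0 : ∫ t, |w' t| ∂circleProb = 0 :=
    le_antisymm (le_of_forall_pos_le_add fun ε hε => by simpa using hle ε hε)
      (integral_nonneg fun t => abs_nonneg _)
  rw [integral_eq_zero_iff_of_nonneg (fun t => abs_nonneg _) hw'i.abs] at h0
  filter_upwards [h0, hww'] with t h1 h2
  rw [h2]
  simpa using h1

/-- There are finitely many roots, and `circleMap` is injective on the half-open period. -/
theorem Polynomial.ae_eval_circleMap_ne_zero {p : Polynomial ℂ} (hp : p ≠ 0) :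
    ∀ᵐ t ∂circleProb, p.eval (circleMap 0 1 t) ≠ 0 := by
  rw [ae_circleProb_iff, ae_restrict_iff' measurableSet_Ioc]
  have hinj : Set.InjOn (circleMap 0 1) (Set.Ioc 0 (2 * π)) := by
    have h := injOn_circleMap_of_abs_sub_le (a := 0) (b := 2 * π) (c := 0) one_ne_zero
      (by simp [abs_of_pos Real.pi_pos])
    rwa [Set.uIoc_of_le (by positivity)] at h
  have hfin : (Set.Ioc 0 (2 * π) ∩ circleMap 0 1 ⁻¹' (p.rootSet ℂ)).Finite :=
    Set.Finite.of_finite_image ((p.rootSet_finite ℂ).subset (by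
      rintro _ ⟨t, ht, rfl⟩
      exact ht.2)) (hinj.mono Set.inter_subset_left)
  rw [ae_iff]
  refine measure_mono_null ?_ (hfin.measure_zero volume)
  intro t ht
  simp only [Set.mem_ofPred_eq, Classical.not_imp, not_not] at ht
  refine ⟨ht.1, ?_⟩
  rw [Set.mem_preimage, Polynomial.mem_rootSet]
  exact ⟨hp, by simpa using ht.2⟩

theorem integral_pow_circleMap {k : ℕ} (hk : k ≠ 0) : ∫ t, (circleMap 0 1 t) ^ k ∂circleProb = 0 := by
  rw [integral_circleProb]
  have h : ∀ t : ℝ, (circleMap 0 1 t) ^ k = Complex.exp ((k * Complex.I) * t) := by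
    intro t
    simp only [circleMap, zero_add, Complex.ofReal_one, one_mul, ← Complex.exp_nat_mul]
    congr 1
    ring
  simp_rw [h]
  have hc : (k : ℂ) * Complex.I ≠ 0 := mul_ne_zero (by exact_mod_cast hk) Complex.I_ne_zero
  rw [integral_exp_mul_complex hc]
  have : Complex.exp ((k * Complex.I) * ((2 * π : ℝ) : ℂ)) = 1 := by
    have := Complex.exp_nat_mul_two_pi_mul_I k
    rw [← this]
    congr 1
    push_cast
    ring
  rw [this]
  simp

theorem Polynomial.integral_eval_circleMap (q : Polynomial ℂ) :
    ∫ t, q.eval (circleMap 0 1 t) ∂circleProb = q.coeff 0 := by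
  have hi : ∀ q : Polynomial ℂ, Integrable (fun t => q.eval (circleMap 0 1 t)) circleProb := by
    intro q
    obtain ⟨R, hR⟩ := q.exists_bound_eval_circleMap
    exact Integrable.of_bound q.continuous_eval_circleMap.aestronglyMeasurable R (ae_of_all _ hR)
  induction q using Polynomial.induction_on' with
  | add p q hp hq =>
    simp only [Polynomial.eval_add, Polynomial.coeff_add]
    rw [integral_add (hi p) (hi q), hp, hq]
  | monomial n a =>
    simp only [Polynomial.eval_monomial]
    rw [integral_const_mul]
    rcases eq_or_ne n 0 with rfl | hn
    · simp
    · rw [integral_pow_circleMap hn, Polynomial.coeff_monomial, if_neg hn, mul_zero]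

theorem Polynomial.integral_re_eval_circleMap (q : Polynomial ℂ) :
    ∫ t, (q.eval (circleMap 0 1 t)).re ∂circleProb = (q.coeff 0).re := by
  have hi : Integrable (fun t => q.eval (circleMap 0 1 t)) circleProb := by
    obtain ⟨R, hR⟩ := q.exists_bound_eval_circleMap
    exact Integrable.of_bound q.continuous_eval_circleMap.aestronglyMeasurable R (ae_of_all _ hR)
  rw [← q.integral_eval_circleMap]
  exact integral_re hi

/-! ### Szegő's infimum over polynomials with constant term one. -/

theorem integrable_normSq_eval_mul {g : ℝ → ℝ} (hg : Integrable g circleProb) (p : Polynomial ℂ) :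
    Integrable (fun t => ‖p.eval (circleMap 0 1 t)‖ ^ 2 * g t) circleProb := by
  obtain ⟨R, hR⟩ := p.exists_bound_eval_circleMap
  refine hg.bdd_mul (c := R ^ 2) (p.continuous_eval_circleMap.norm.pow 2).aestronglyMeasurable
    (ae_of_all _ fun t => ?_)
  rw [norm_pow, norm_norm]
  exact pow_le_pow_left₀ (norm_nonneg _) (hR t) 2

/-- The lower bound in Szegő's infimum, by the inequalities of Jensen. -/
theorem exp_integral_log_le_integral {g : ℝ → ℝ} (hg : Integrable g circleProb)
    (hpos : ∀ᵐ t ∂circleProb, 0 < g t) (hlog : Integrable (fun t => Real.log (g t)) circleProb)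
    {p : Polynomial ℂ} (hp : p.coeff 0 = 1) :
    Real.exp (∫ t, Real.log (g t) ∂circleProb) ≤
      ∫ t, ‖p.eval (circleMap 0 1 t)‖ ^ 2 * g t ∂circleProb := by
  have hp0 : p ≠ 0 := by
    rintro rfl
    simp at hp
  have hlogp : Integrable (fun t => Real.log ‖p.eval (circleMap 0 1 t)‖) circleProb :=
    integrable_circleProb_iff.2 p.intervalIntegrable_mahlerMeasure
  -- The Mahler measure of `p` is at least `|p(0)| = 1`.
  have hmahler : 0 ≤ ∫ t, Real.log ‖p.eval (circleMap 0 1 t)‖ ∂circleProb := by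
    have h1 : 1 ≤ p.mahlerMeasure := by
      simpa [hp] using p.norm_coeff_le_choose_mul_mahlerMeasure 0
    have h2 := Real.log_nonneg h1
    rw [← Polynomial.logMahlerMeasure_eq_log_MahlerMeasure, Polynomial.logMahlerMeasure_def,
      Real.circleAverage_def] at h2
    rwa [integral_circleProb]
  have hexp : (fun t => Real.exp (Real.log (g t) + 2 * Real.log ‖p.eval (circleMap 0 1 t)‖))
      =ᵐ[circleProb] fun t => ‖p.eval (circleMap 0 1 t)‖ ^ 2 * g t := by
    filter_upwards [hpos, Polynomial.ae_eval_circleMap_ne_zero hp0] with t h1 h2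
    rw [Real.exp_add, Real.exp_log h1, two_mul, Real.exp_add, Real.exp_log (norm_pos_iff.2 h2)]
    ring
  have hi := hlog.add (hlogp.const_mul 2)
  -- Jensen's inequality for `exp`, applied to `log (|p|² g)`.
  have hJ := convexOn_exp.map_integral_le (μ := circleProb) Real.continuous_exp.continuousOn
    isClosed_univ (ae_of_all _ fun _ => Set.mem_univ _) hi
    ((integrable_normSq_eval_mul hg p).congr hexp.symm)
  refine le_trans (Real.exp_le_exp.2 ?_) (hJ.trans (le_of_eq (integral_congr_ae hexp)))
  simp only [Pi.add_apply]
  rw [integral_add hlog (hlogp.const_mul 2), integral_const_mul]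
  linarith

/-- The Taylor polynomial of `exp` evaluated at half a polynomial. -/
noncomputable def expHalfTaylor (q : Polynomial ℂ) (K : ℕ) : Polynomial ℂ :=
  ∑ k ∈ Finset.range K, Polynomial.C ((k.factorial : ℂ)⁻¹) * (Polynomial.C (1 / 2) * q) ^ k

theorem eval_expHalfTaylor (q : Polynomial ℂ) (K : ℕ) (z : ℂ) :
    (expHalfTaylor q K).eval z =
      ∑ k ∈ Finset.range K, (q.eval z / 2) ^ k / (k.factorial : ℂ) := by
  rw [expHalfTaylor, Polynomial.eval_finsetSum]
  refine Finset.sum_congr rfl fun k _ => ?_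
  simp only [Polynomial.eval_mul, Polynomial.eval_C, Polynomial.eval_pow]
  ring

/-- The index `K + 1` ensures that the term `k = 0` is present; all the others vanish at the origin.
-/
theorem coeff_zero_expHalfTaylor {q : Polynomial ℂ} (hq : q.coeff 0 = 0) (K : ℕ) :
    (expHalfTaylor q (K + 1)).coeff 0 = 1 := by
  rw [Polynomial.coeff_zero_eq_eval_zero, eval_expHalfTaylor, ← Polynomial.coeff_zero_eq_eval_zero,
    hq, Finset.sum_range_succ']
  simp

theorem norm_eval_expHalfTaylor_le (q : Polynomial ℂ) (K : ℕ) (z : ℂ) :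
    ‖(expHalfTaylor q K).eval z‖ ≤ Real.exp (‖q.eval z‖ / 2) := by
  rw [eval_expHalfTaylor]
  refine (norm_sum_le _ _).trans ?_
  refine le_trans (le_of_eq (Finset.sum_congr rfl fun k _ => ?_))
    (Real.sum_le_exp_of_nonneg (div_nonneg (norm_nonneg (q.eval z)) zero_le_two) K)
  simp

theorem tendsto_eval_expHalfTaylor (q : Polynomial ℂ) (z : ℂ) :
    Tendsto (fun K => (expHalfTaylor q K).eval z) atTop (𝓝 (Complex.exp (q.eval z / 2))) := by
  simp_rw [eval_expHalfTaylor]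
  rw [Complex.exp_eq_exp_ℂ]
  exact (NormedSpace.expSeries_div_hasSum_exp (q.eval z / 2)).tendsto_sum_nat

/-- The Taylor polynomials of `exp (q/2)` are admissible in `hc`, and `|exp (q/2)|² = exp (Re q)`.
Since `q` is bounded on the circle, dominated convergence applies. -/
theorem le_integral_exp_re_of_coeff_zero {g : ℝ → ℝ} (hg : Integrable g circleProb) {c : ℝ}
    (hc : ∀ p : Polynomial ℂ, p.coeff 0 = 1 →
      c ≤ ∫ t, ‖p.eval (circleMap 0 1 t)‖ ^ 2 * g t ∂circleProb)
    {q : Polynomial ℂ} (hq : q.coeff 0 = 0) :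
    c ≤ ∫ t, Real.exp (q.eval (circleMap 0 1 t)).re * g t ∂circleProb := by
  obtain ⟨R, hR⟩ := q.exists_bound_eval_circleMap
  have hlim : Tendsto (fun K => ∫ t, ‖(expHalfTaylor q (K + 1)).eval (circleMap 0 1 t)‖ ^ 2 * g t
      ∂circleProb) atTop
      (𝓝 (∫ t, Real.exp (q.eval (circleMap 0 1 t)).re * g t ∂circleProb)) := by
    refine tendsto_integral_of_dominated_convergence (fun t => Real.exp (R / 2) ^ 2 * |g t|)
      (fun K => (integrable_normSq_eval_mul hg _).aestronglyMeasurable)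
      (hg.abs.const_mul _) (fun K => ae_of_all _ fun t => ?_) (ae_of_all _ fun t => ?_)
    · rw [norm_mul, norm_pow, norm_norm, Real.norm_eq_abs]
      refine mul_le_mul_of_nonneg_right (pow_le_pow_left₀ (norm_nonneg _) ?_ 2) (abs_nonneg _)
      refine (norm_eval_expHalfTaylor_le _ _ _).trans (Real.exp_le_exp.2 ?_)
      linarith [hR t]
    · have h1 := ((tendsto_eval_expHalfTaylor q (circleMap 0 1 t)).comp
        (tendsto_add_atTop_nat 1)).norm.pow 2
      have h2 : ‖Complex.exp (q.eval (circleMap 0 1 t) / 2)‖ ^ 2 =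
          Real.exp (q.eval (circleMap 0 1 t)).re := by
        rw [Complex.norm_exp, ← Real.exp_nat_mul]
        congr 1
        simp
        ring
      rw [h2] at h1
      exact h1.mul_const (g t)
  exact ge_of_tendsto' hlim fun K => hc _ (coeff_zero_expHalfTaylor hq K)

/-- Subtracting the constant term reduces to `q(0) = 0`; the factor this produces is the exponential
of the mean of `Re q`. -/
theorem mul_exp_integral_le_integral_exp_re {g : ℝ → ℝ} (hg : Integrable g circleProb) {c : ℝ}
    (hc : ∀ p : Polynomial ℂ, p.coeff 0 = 1 →
      c ≤ ∫ t, ‖p.eval (circleMap 0 1 t)‖ ^ 2 * g t ∂circleProb) (q : Polynomial ℂ) :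
    c * Real.exp (∫ t, (q.eval (circleMap 0 1 t)).re ∂circleProb) ≤
      ∫ t, Real.exp (q.eval (circleMap 0 1 t)).re * g t ∂circleProb := by
  have h := le_integral_exp_re_of_coeff_zero hg hc (q := q - Polynomial.C (q.coeff 0)) (by simp)
  rw [q.integral_re_eval_circleMap]
  have h2 : ∀ t, Real.exp ((q - Polynomial.C (q.coeff 0)).eval (circleMap 0 1 t)).re * g t =
      Real.exp (-(q.coeff 0).re) * (Real.exp (q.eval (circleMap 0 1 t)).re * g t) := by
    intro t
    rw [Polynomial.eval_sub, Polynomial.eval_C, Complex.sub_re, sub_eq_add_neg, Real.exp_add]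
    ring
  simp_rw [h2] at h
  rw [integral_const_mul, Real.exp_neg, ← div_eq_inv_mul, le_div_iff₀ (Real.exp_pos _)] at h
  exact h

theorem abs_exp_sub_exp_le {a b M : ℝ} (ha : a ≤ M) (hb : b ≤ M) :
    |Real.exp a - Real.exp b| ≤ Real.exp M * |a - b| := by
  wlog hab : b ≤ a generalizing a b
  · rw [abs_sub_comm, abs_sub_comm a]
    exact this hb ha (le_of_not_ge hab)
  rw [abs_of_nonneg (sub_nonneg.2 (Real.exp_le_exp.2 hab)), abs_of_nonneg (sub_nonneg.2 hab)]
  have h1 := Real.add_one_le_exp (b - a)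
  have h2 : Real.exp b = Real.exp a * Real.exp (b - a) := by rw [← Real.exp_add]; ring_nf
  calc Real.exp a - Real.exp b = Real.exp a * (1 - Real.exp (b - a)) := by rw [h2]; ring
    _ ≤ Real.exp a * (a - b) := mul_le_mul_of_nonneg_left (by linarith) (Real.exp_pos _).le
    _ ≤ Real.exp M * (a - b) := by
      have := sub_nonneg.2 hab
      gcongr

/-- The left side needs approximation of `u` in mean for `circleProb`, the right side for the
measure with density `g`; approximating for their sum gives both at once. The uniform bound `N + 1`
makes `exp` Lipschitz on the values involved. -/
theorem mul_exp_integral_le_integral_exp {g : ℝ → ℝ} (hg : Integrable g circleProb)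
    (hg0 : ∀ᵐ t ∂circleProb, 0 ≤ g t) {c : ℝ}
    (hc : ∀ p : Polynomial ℂ, p.coeff 0 = 1 →
      c ≤ ∫ t, ‖p.eval (circleMap 0 1 t)‖ ^ 2 * g t ∂circleProb)
    {u : ℝ → ℝ} (hu : Measurable u) {N : ℝ} (hN : ∀ t, |u t| ≤ N) :
    c * Real.exp (∫ t, u t ∂circleProb) ≤ ∫ t, Real.exp (u t) * g t ∂circleProb := by
  set ρ₁ : Measure ℝ := circleProb.withDensity fun t => ENNReal.ofReal (g t) with hρ₁
  have hfin : IsFiniteMeasure ρ₁ := isFiniteMeasure_withDensity_ofReal hg.2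
  have hρ : (circleProb + ρ₁) (Set.Ioc 0 (2 * π))ᶜ = 0 := by
    rw [Measure.add_apply, circleProb_compl_Ioc,
      withDensity_absolutelyContinuous _ _ circleProb_compl_Ioc, add_zero]
  have hρint : ∀ φ : ℝ → ℝ, ∫ t, φ t ∂ρ₁ = ∫ t, g t * φ t ∂circleProb := by
    intro φ
    rw [hρ₁, integral_withDensity_eq_integral_toReal_smul₀ hg.aestronglyMeasurable.aemeasurable.ennreal_ofReal
      (by simp)]
    refine integral_congr_ae ?_
    filter_upwards [hg0] with t ht
    rw [ENNReal.toReal_ofReal ht, smul_eq_mul]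
  choose q hqb hq using fun k : ℕ =>
    exists_polynomial_re_near_bounded hρ hu hN (Nat.one_div_pos_of_nat (n := k) (α := ℝ))
  have hqm : ∀ k, Measurable fun t => ((q k).eval (circleMap 0 1 t)).re := fun k =>
    (Complex.continuous_re.comp (q k).continuous_eval_circleMap).measurable
  have hdi : ∀ k (ν : Measure ℝ) [IsFiniteMeasure ν],
      Integrable (fun t => |u t - ((q k).eval (circleMap 0 1 t)).re|) ν := by
    intro k ν _
    refine Integrable.of_bound (C := 2 * N + 1) ((hu.sub (hqm k)).abs).aestronglyMeasurable
      (ae_of_all _ fun t => ?_)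
    have h1 := hN t
    have h2 := hqb k t
    rw [Real.norm_eq_abs, abs_abs]
    rw [abs_le] at h1 h2 ⊢
    constructor <;> linarith
  have hsmall : ∀ k, ∫ t, |u t - ((q k).eval (circleMap 0 1 t)).re| ∂circleProb ≤ 1 / ((k : ℝ) + 1) ∧
      ∫ t, |u t - ((q k).eval (circleMap 0 1 t)).re| ∂ρ₁ ≤ 1 / ((k : ℝ) + 1) := by
    intro k
    have h := hq k
    rw [integral_add_measure (hdi k _) (hdi k _)] at h
    have h1 : 0 ≤ ∫ t, |u t - ((q k).eval (circleMap 0 1 t)).re| ∂circleProb :=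
      integral_nonneg fun t => abs_nonneg _
    have h2 : 0 ≤ ∫ t, |u t - ((q k).eval (circleMap 0 1 t)).re| ∂ρ₁ :=
      integral_nonneg fun t => abs_nonneg _
    constructor <;> linarith
  have hui : Integrable u circleProb :=
    Integrable.of_bound hu.aestronglyMeasurable N (ae_of_all _ hN)
  have hqi : ∀ k, Integrable (fun t => ((q k).eval (circleMap 0 1 t)).re) circleProb := fun k =>
    Integrable.of_bound (hqm k).aestronglyMeasurable (N + 1) (ae_of_all _ (hqb k))
  have hexpi : ∀ {w : ℝ → ℝ}, Measurable w → (∀ t, |w t| ≤ N + 1) →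
      Integrable (fun t => Real.exp (w t) * g t) circleProb := by
    intro w hw hwN
    refine hg.bdd_mul (c := Real.exp (N + 1)) hw.exp.aestronglyMeasurable (ae_of_all _ fun t => ?_)
    rw [Real.norm_eq_abs, Real.abs_exp]
    exact Real.exp_le_exp.2 ((le_abs_self _).trans (hwN t))
  have hlim1 : Tendsto (fun k => ∫ t, ((q k).eval (circleMap 0 1 t)).re ∂circleProb) atTop
      (𝓝 (∫ t, u t ∂circleProb)) := by
    rw [tendsto_iff_norm_sub_tendsto_zero]
    refine squeeze_zero (fun _ => norm_nonneg _) (fun k => ?_) tendsto_one_div_add_atTop_nhds_zero_nat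
    rw [← integral_sub (hqi k) hui]
    refine (norm_integral_le_integral_norm _).trans (le_trans (le_of_eq ?_) (hsmall k).1)
    refine integral_congr_ae (ae_of_all _ fun t => ?_)
    simp only [Real.norm_eq_abs]
    exact abs_sub_comm _ _
  have hlim2 : Tendsto (fun k => ∫ t, Real.exp ((q k).eval (circleMap 0 1 t)).re * g t ∂circleProb)
      atTop (𝓝 (∫ t, Real.exp (u t) * g t ∂circleProb)) := by
    rw [tendsto_iff_norm_sub_tendsto_zero]
    have h0 : Tendsto (fun k : ℕ => Real.exp (N + 1) * (1 / ((k : ℝ) + 1))) atTop (𝓝 0) := by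
      simpa using tendsto_one_div_add_atTop_nhds_zero_nat.const_mul (Real.exp (N + 1))
    refine squeeze_zero (fun _ => norm_nonneg _) (fun k => ?_) h0
    have huN : ∀ t, |u t| ≤ N + 1 := fun t => (hN t).trans (by linarith)
    rw [← integral_sub (hexpi (hqm k) (hqb k)) (hexpi hu huN)]
    refine (norm_integral_le_integral_norm _).trans ?_
    have hgd : Integrable (fun t => g t * |u t - ((q k).eval (circleMap 0 1 t)).re|) circleProb := by
      refine hg.mul_bdd (c := 2 * N + 1) ((hu.sub (hqm k)).abs).aestronglyMeasurable
        (ae_of_all _ fun t => ?_)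
      have h1 := hN t
      have h2 := hqb k t
      rw [Real.norm_eq_abs, abs_abs]
      rw [abs_le] at h1 h2 ⊢
      constructor <;> linarith
    calc ∫ t, ‖Real.exp ((q k).eval (circleMap 0 1 t)).re * g t - Real.exp (u t) * g t‖ ∂circleProb
        ≤ ∫ t, Real.exp (N + 1) * (g t * |u t - ((q k).eval (circleMap 0 1 t)).re|) ∂circleProb := by
          refine integral_mono_ae ((hexpi (hqm k) (hqb k)).sub (hexpi hu huN)).norm
            (hgd.const_mul _) ?_
          filter_upwards [hg0] with t ht
          rw [← sub_mul, norm_mul, Real.norm_eq_abs, Real.norm_eq_abs, abs_of_nonneg ht,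
            mul_left_comm, mul_comm, abs_sub_comm (u t)]
          exact mul_le_mul_of_nonneg_left (abs_exp_sub_exp_le ((le_abs_self _).trans (hqb k t))
            ((le_abs_self _).trans (huN t))) ht
      _ ≤ Real.exp (N + 1) * (1 / ((k : ℝ) + 1)) := by
          rw [integral_const_mul, ← hρint]
          exact mul_le_mul_of_nonneg_left (hsmall k).2 (Real.exp_pos _).le
  exact le_of_tendsto_of_tendsto' (((Real.continuous_exp.tendsto _).comp hlim1).const_mul c) hlim2
    fun k => mul_exp_integral_le_integral_exp_re hg hc (q k)

/-- The upper bound in Szegő's infimum. -/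
theorem le_exp_integral_log {g : ℝ → ℝ} (hg : Integrable g circleProb)
    (hpos : ∀ᵐ t ∂circleProb, 0 < g t) (hlog : Integrable (fun t => Real.log (g t)) circleProb)
    {c : ℝ} (hc : ∀ p : Polynomial ℂ, p.coeff 0 = 1 →
      c ≤ ∫ t, ‖p.eval (circleMap 0 1 t)‖ ^ 2 * g t ∂circleProb) :
    c ≤ Real.exp (∫ t, Real.log (g t) ∂circleProb) := by
  set l := hlog.aestronglyMeasurable.mk _ with hl
  have hlm : Measurable l := hlog.aestronglyMeasurable.stronglyMeasurable_mk.measurable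
  have hll : (fun t => Real.log (g t)) =ᵐ[circleProb] l := hlog.aestronglyMeasurable.ae_eq_mk
  -- The ideal choice `u = -log g` would give `exp u * g = 1`, but it need not be bounded, so it is
  -- truncated at `±N`.
  set u : ℕ → ℝ → ℝ := fun N t => max (-(N : ℝ)) (min (-l t) N) with hu
  have hum : ∀ N, Measurable (u N) := fun N =>
    measurable_const.max (hlm.neg.min measurable_const)
  have huN : ∀ N t, |u N t| ≤ N := fun N t =>
    abs_le.2 ⟨le_max_left _ _, max_le (by have := N.cast_nonneg (α := ℝ); linarith)
      (min_le_right _ _)⟩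
  have hul : ∀ t, ∀ᶠ N : ℕ in atTop, u N t = -l t := by
    intro t
    filter_upwards [eventually_ge_atTop ⌈|l t|⌉₊] with N hNt
    have h1 : |l t| ≤ N := (Nat.le_ceil _).trans (by exact_mod_cast hNt)
    rw [abs_le] at h1
    rw [hu]
    simp only
    rw [min_eq_left (by linarith), max_eq_right (by linarith)]
  have hlim1 : Tendsto (fun N => ∫ t, u N t ∂circleProb) atTop
      (𝓝 (∫ t, -Real.log (g t) ∂circleProb)) := by
    refine tendsto_integral_of_dominated_convergence (fun t => |Real.log (g t)|)
      (fun N => (hum N).aestronglyMeasurable) hlog.abs (fun N => ?_) ?_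
    · filter_upwards [hll] with t ht
      have h0 : (0 : ℝ) ≤ N := N.cast_nonneg
      have h1 := neg_abs_le (l t)
      have h2 := le_abs_self (l t)
      have h3 := abs_nonneg (l t)
      rw [ht, Real.norm_eq_abs, abs_le]
      constructor
      · rcases le_total (-l t) N with h | h
        · exact le_trans (by rw [min_eq_left h]; linarith) (le_max_right _ _)
        · exact le_trans (by rw [min_eq_right h]; linarith) (le_max_right _ _)
      · exact max_le (by linarith) ((min_le_left _ _).trans (by linarith))
    · filter_upwards [hll] with t ht
      rw [ht]
      exact tendsto_const_nhds.congr' ((hul t).mono fun N h => h.symm)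
  have hlim2 : Tendsto (fun N => ∫ t, Real.exp (u N t) * g t ∂circleProb) atTop
      (𝓝 (∫ _, (1 : ℝ) ∂circleProb)) := by
    -- Where the lower truncation acts, `u ≤ 0` and the integrand is at most `g`; elsewhere `u ≤
    -- -log g` and it is at most `1`.
    refine tendsto_integral_of_dominated_convergence (fun t => 1 + g t)
      (fun N => (hum N).exp.aestronglyMeasurable.mul hg.aestronglyMeasurable)
      ((integrable_const _).add hg) (fun N => ?_) ?_
    · filter_upwards [hll, hpos] with t ht h0
      rw [norm_mul, Real.norm_eq_abs, Real.norm_eq_abs, Real.abs_exp, abs_of_pos h0]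
      rcases le_total (-(N : ℝ)) (min (-l t) N) with h | h
      · have : u N t ≤ -Real.log (g t) := by
          rw [hu, ht]
          simp only
          rw [max_eq_right h]
          exact min_le_left _ _
        calc Real.exp (u N t) * g t ≤ Real.exp (-Real.log (g t)) * g t := by gcongr
          _ = 1 := by rw [Real.exp_neg, Real.exp_log h0, inv_mul_cancel₀ h0.ne']
          _ ≤ 1 + g t := by linarith
      · have : u N t ≤ 0 := by
          rw [hu]
          simp only
          rw [max_eq_left h]
          simp
        calc Real.exp (u N t) * g t ≤ 1 * g t := by
              gcongr
              exact Real.exp_le_one_iff.2 this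
          _ ≤ 1 + g t := by linarith
    · filter_upwards [hll, hpos] with t ht h0
      refine tendsto_const_nhds.congr' ((hul t).mono fun N h => ?_)
      simp only
      rw [h, ← ht, Real.exp_neg, Real.exp_log h0, inv_mul_cancel₀ h0.ne']
  have h := le_of_tendsto_of_tendsto' (((Real.continuous_exp.tendsto _).comp hlim1).const_mul c)
    hlim2 fun N => mul_exp_integral_le_integral_exp hg (hpos.mono fun t => le_of_lt) hc (hum N) (huN N)
  rw [integral_neg, Real.exp_neg] at h
  simp only [integral_const, probReal_univ, smul_eq_mul, mul_one] at h
  rwa [← div_eq_mul_inv, div_le_one (Real.exp_pos _)] at h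

/-! ### Toeplitz determinants and Szegő's limit theorem. -/

/-- The symmetric Toeplitz matrix of a sequence. -/
def toeplitz (r : ℕ → ℝ) (n : ℕ) : Matrix (Fin n) (Fin n) ℝ :=
  Matrix.of fun i j => r (Nat.dist i j)

theorem toeplitz_apply (r : ℕ → ℝ) {n : ℕ} (i j : Fin n) : toeplitz r n i j = r (Nat.dist i j) := rfl

theorem toeplitz_isHermitian (r : ℕ → ℝ) (n : ℕ) : (toeplitz r n).IsHermitian :=
  Matrix.IsHermitian.ext fun i j => by simp [toeplitz_apply, Nat.dist_comm]

theorem toeplitz_submatrix_succ (r : ℕ → ℝ) (n : ℕ) :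
    (toeplitz r (n + 1)).submatrix Fin.succ Fin.succ = toeplitz r n := by
  ext i j
  simp [toeplitz_apply, Nat.dist]

/-- The quadratic minimization expressing the ratio of consecutive principal minors. -/
theorem Matrix.PosDef.exists_min_quadratic {n : ℕ} {M : Matrix (Fin (n + 1)) (Fin (n + 1)) ℝ}
    (hM : M.PosDef) : ∃ x : Fin (n + 1) → ℝ, x 0 = 1 ∧
      M.det = (M.submatrix Fin.succ Fin.succ).det * (x ⬝ᵥ M.mulVec x) ∧
      ∀ y : Fin (n + 1) → ℝ, y 0 = 1 → x ⬝ᵥ M.mulVec x ≤ y ⬝ᵥ M.mulVec y := by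
  have hdet := hM.det_pos
  -- By Cramer's rule `a` is the ratio of the minor to the determinant, so the minimum will be
  -- `a⁻¹`.
  set a : ℝ := M⁻¹ 0 0 with ha
  have ha0 : 0 < a := hM.inv.diag_pos
  have hadet : a * M.det = (M.submatrix Fin.succ Fin.succ).det := by
    have h : M⁻¹ 0 0 = M.det⁻¹ * M.adjugate 0 0 := by
      rw [Matrix.inv_def, Matrix.smul_apply, Ring.inverse_eq_inv', smul_eq_mul]
    rw [ha, h, Matrix.adjugate_fin_succ_eq_det_submatrix]
    simp only [Fin.val_zero, add_zero, pow_zero, one_mul, Fin.succAbove_zero]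
    field_simp
  -- The minimizer makes `M x` proportional to the first basis vector, so `x` is `M`-orthogonal to
  -- every `y - x` with `y 0 = 1`.
  set x : Fin (n + 1) → ℝ := a⁻¹ • M⁻¹.mulVec (Pi.single 0 1) with hx
  have hx0 : x 0 = 1 := by
    rw [hx, Pi.smul_apply, Matrix.mulVec_single_one, Matrix.col_apply, smul_eq_mul, ← ha,
      inv_mul_cancel₀ ha0.ne']
  have hMx : M.mulVec x = a⁻¹ • Pi.single 0 1 := by
    rw [hx, Matrix.mulVec_smul, Matrix.mulVec_mulVec,
      Matrix.mul_nonsing_inv _ (isUnit_iff_ne_zero.2 hdet.ne'), Matrix.one_mulVec]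
  have hdot : ∀ y : Fin (n + 1) → ℝ, y ⬝ᵥ M.mulVec x = a⁻¹ * y 0 := by
    intro y
    rw [hMx, dotProduct_smul, dotProduct_single, mul_one, smul_eq_mul]
  refine ⟨x, hx0, ?_, fun y hy => ?_⟩
  · rw [hdot, hx0, ← hadet, mul_one]
    field_simp
  · have hsymm : x ⬝ᵥ M.mulVec (y - x) = (y - x) ⬝ᵥ M.mulVec x := by
      rw [Matrix.dotProduct_mulVec, ← Matrix.mulVec_transpose, dotProduct_comm]
      have := hM.isHermitian.eq
      rw [Matrix.conjTranspose_eq_transpose_of_trivial] at this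
      rw [this]
    have hnn : 0 ≤ (y - x) ⬝ᵥ M.mulVec (y - x) := by
      simpa using hM.posSemidef.dotProduct_mulVec_nonneg (y - x)
    have h0 : (y - x) ⬝ᵥ M.mulVec x = 0 := by
      rw [hdot, Pi.sub_apply, hy, hx0, sub_self, mul_zero]
    have : y ⬝ᵥ M.mulVec y = x ⬝ᵥ M.mulVec x + x ⬝ᵥ M.mulVec (y - x) +
        ((y - x) ⬝ᵥ M.mulVec x + (y - x) ⬝ᵥ M.mulVec (y - x)) := by
      rw [← dotProduct_add, ← dotProduct_add, ← Matrix.mulVec_add, ← add_dotProduct]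
      simp
    rw [this, hsymm, h0]
    linarith

theorem circleMap_zero_one_pow_mul_conj_pow (t : ℝ) (i j : ℕ) :
    circleMap 0 1 t ^ i * (starRingEnd ℂ) (circleMap 0 1 t) ^ j =
      Complex.exp (((i : ℂ) - j) * t * Complex.I) := by
  simp only [circleMap, zero_add, Complex.ofReal_one, one_mul, ← Complex.exp_conj,
    ← Complex.exp_nat_mul, ← Complex.exp_add, map_mul, Complex.conj_ofReal, Complex.conj_I]
  congr 1
  ring

/-- A real sequence given by the Fourier coefficients of a real function on the circle. -/
def IsFourierSeq (r : ℕ → ℝ) (g : ℝ → ℝ) : Prop :=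
  ∀ k : ℕ, ∫ t, (g t : ℂ) * circleMap 0 1 t ^ k ∂circleProb = r k

theorem IsPowerSpectralDensity.integrable {r : ℕ → ℝ} {g : ℝ → ℝ}
    (h : IsPowerSpectralDensity r g) : Integrable g circleProb :=
  integrable_circleProb_iff.2 h.intervalIntegrable

/-- Both `g` and `r` are real, so conjugation reverses the sign in the exponential. -/
theorem IsPowerSpectralDensity.isFourierSeq {r : ℕ → ℝ} {g : ℝ → ℝ}
    (h : IsPowerSpectralDensity r g) : IsFourierSeq r g := by
  intro k
  have h1 : ∫ t, (g t : ℂ) * Complex.exp (-(Complex.I * k * t)) ∂circleProb = r k := by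
    rw [h.fourier k, integral_circleProb, Complex.real_smul]
    push_cast
    rw [one_div]
  have h2 := congrArg (starRingEnd ℂ) h1
  rw [← integral_conj, Complex.conj_ofReal] at h2
  rw [← h2]
  refine integral_congr_ae (ae_of_all _ fun t => ?_)
  simp only [map_mul, Complex.conj_ofReal, ← Complex.exp_conj, map_neg, Complex.conj_I,
    map_natCast, circleMap, zero_add, Complex.ofReal_one, one_mul, ← Complex.exp_nat_mul]
  congr 2
  ring

namespace IsFourierSeq

variable {r : ℕ → ℝ} {g : ℝ → ℝ}

theorem integral_mul_pow_mul_conj_pow (h : IsFourierSeq r g) (i j : ℕ) :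
    ∫ t, (g t : ℂ) * (circleMap 0 1 t ^ i * (starRingEnd ℂ) (circleMap 0 1 t) ^ j) ∂circleProb =
      r (Nat.dist i j) := by
  have hle : ∀ a b : ℕ, b ≤ a → ∫ t, (g t : ℂ) *
      (circleMap 0 1 t ^ a * (starRingEnd ℂ) (circleMap 0 1 t) ^ b) ∂circleProb =
      r (Nat.dist a b) := by
    intro a b hab
    rw [Nat.dist_eq_sub_of_le_right hab, ← h (a - b)]
    refine integral_congr_ae (ae_of_all _ fun t => ?_)
    have h2 := circleMap_zero_one_pow_mul_conj_pow t (a - b) 0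
    have h3 := circleMap_zero_one_pow_mul_conj_pow t a b
    simp only
    rw [h3, ← mul_one (circleMap 0 1 t ^ (a - b)),
      ← pow_zero ((starRingEnd ℂ) (circleMap 0 1 t)), h2, Nat.cast_sub hab]
    simp
  rcases le_total j i with hij | hij
  · exact hle i j hij
  · have h1 := congrArg (starRingEnd ℂ) (hle j i hij)
    rw [← integral_conj, Complex.conj_ofReal, Nat.dist_comm] at h1
    rw [← h1]
    refine integral_congr_ae (ae_of_all _ fun t => ?_)
    simp only [map_mul, map_pow, Complex.conj_ofReal, Complex.conj_conj]
    ring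

/-- The Hermitian form of a real symmetric matrix separates into real and imaginary parts. Hence
complex coefficients cannot improve on real ones in the minimization. -/
theorem integral_normSq_sum (h : IsFourierSeq r g) (hg : Integrable g circleProb) {n : ℕ}
    (c : Fin n → ℂ) :
    ∫ t, ‖∑ i, c i * circleMap 0 1 t ^ (i : ℕ)‖ ^ 2 * g t ∂circleProb =
      (fun i => (c i).re) ⬝ᵥ (toeplitz r n).mulVec (fun i => (c i).re) +
      (fun i => (c i).im) ⬝ᵥ (toeplitz r n).mulVec (fun i => (c i).im) := by
  have hi : ∀ i j : Fin n, Integrable (fun t => (c i * (starRingEnd ℂ) (c j)) * ((g t : ℂ) *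
      (circleMap 0 1 t ^ (i : ℕ) * (starRingEnd ℂ) (circleMap 0 1 t) ^ (j : ℕ)))) circleProb := by
    intro i j
    refine (hg.ofReal.mul_bdd (c := 1) ?_ (ae_of_all _ fun t => ?_)).const_mul _
    · exact (((continuous_circleMap 0 1).pow _).mul
        ((Complex.continuous_conj.comp (continuous_circleMap 0 1)).pow _)).aestronglyMeasurable
    · simp
  have hC : ((∫ t, ‖∑ i, c i * circleMap 0 1 t ^ (i : ℕ)‖ ^ 2 * g t ∂circleProb : ℝ) : ℂ) =
      ∑ i, ∑ j, (c i * (starRingEnd ℂ) (c j)) * r (Nat.dist i j) := by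
    rw [← integral_complex_ofReal]
    simp_rw [← h.integral_mul_pow_mul_conj_pow, ← integral_const_mul]
    simp_rw [← integral_finsetSum _ fun j _ => hi _ j]
    rw [← integral_finsetSum _ fun i _ => integrable_finsetSum _ fun j _ => hi i j]
    refine integral_congr_ae (ae_of_all _ fun t => ?_)
    simp only
    rw [Complex.ofReal_mul, Complex.ofReal_pow, ← Complex.mul_conj', map_sum, Finset.sum_mul_sum,
      Finset.sum_mul]
    refine Finset.sum_congr rfl fun i _ => ?_
    rw [Finset.sum_mul]
    refine Finset.sum_congr rfl fun j _ => ?_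
    rw [map_mul, map_pow]
    ring
  have hre := congrArg Complex.re hC
  rw [Complex.ofReal_re] at hre
  rw [hre]
  simp only [dotProduct, Matrix.mulVec, Complex.re_sum, toeplitz_apply, Finset.mul_sum,
    ← Finset.sum_add_distrib]
  refine Finset.sum_congr rfl fun i _ => Finset.sum_congr rfl fun j _ => ?_
  simp only [Complex.mul_re, Complex.conj_re, Complex.conj_im, Complex.ofReal_re,
    Complex.ofReal_im]
  ring

theorem dotProduct_toeplitz_mulVec (h : IsFourierSeq r g) (hg : Integrable g circleProb) {n : ℕ}
    (x : Fin n → ℝ) :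
    x ⬝ᵥ (toeplitz r n).mulVec x =
      ∫ t, ‖(∑ i : Fin n, Polynomial.monomial (i : ℕ) (x i : ℂ)).eval (circleMap 0 1 t)‖ ^ 2 * g t
        ∂circleProb := by
  have h1 := h.integral_normSq_sum hg fun i => (x i : ℂ)
  simp only [Complex.ofReal_re, Complex.ofReal_im] at h1
  have h0 : ((fun _ => 0 : Fin n → ℝ)) = 0 := rfl
  rw [h0, zero_dotProduct, add_zero] at h1
  rw [← h1]
  simp [Polynomial.eval_finsetSum]

/-- If `∫ |p|² g = 0` with `p ≠ 0`, then `g` vanishes almost everywhere, contradicting `r 0 ≠ 0`.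
Strict positivity of `g` is not needed, which matters for the density of `X`. -/
theorem toeplitz_posDef (h : IsFourierSeq r g) (hg : Integrable g circleProb)
    (hg0 : ∀ᵐ t ∂circleProb, 0 ≤ g t) (hr : r 0 ≠ 0) (n : ℕ) : (toeplitz r n).PosDef := by
  refine Matrix.PosDef.of_dotProduct_mulVec_pos (toeplitz_isHermitian r n) fun x hx => ?_
  rw [star_trivial, h.dotProduct_toeplitz_mulVec hg]
  set p : Polynomial ℂ := ∑ i : Fin n, Polynomial.monomial (i : ℕ) (x i : ℂ) with hp
  have hp0 : p ≠ 0 := by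
    obtain ⟨i, hi⟩ := Function.ne_iff.1 hx
    intro h0
    have h1 := congrArg (fun q => Polynomial.coeff q (i : ℕ)) h0
    simp only [hp, Polynomial.finsetSum_coeff, Polynomial.coeff_monomial, Fin.val_inj,
      Finset.sum_ite_eq', Finset.mem_univ, if_true, Polynomial.coeff_zero] at h1
    exact hi (by exact_mod_cast h1)
  have hnn : 0 ≤ᵐ[circleProb] fun t => ‖p.eval (circleMap 0 1 t)‖ ^ 2 * g t := by
    filter_upwards [hg0] with t ht
    exact mul_nonneg (sq_nonneg _) ht
  refine lt_of_le_of_ne (integral_nonneg_of_ae hnn) fun h0 => hr ?_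
  have h1 := (integral_eq_zero_iff_of_nonneg_ae hnn (integrable_normSq_eval_mul hg p)).1 h0.symm
  have h2 : ∀ᵐ t ∂circleProb, g t = 0 := by
    filter_upwards [h1, p.ae_eval_circleMap_ne_zero hp0] with t ht hpt
    simpa [hpt] using ht
  have h3 := h 0
  rw [integral_eq_zero_of_ae (by filter_upwards [h2] with t ht; simp [ht])] at h3
  exact_mod_cast h3.symm

theorem apply_zero_ne_zero (h : IsFourierSeq r g) (hg : Integrable g circleProb)
    (hpos : ∀ᵐ t ∂circleProb, 0 < g t) : r 0 ≠ 0 := by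
  intro h0
  have h1 := h 0
  simp only [pow_zero, mul_one, h0] at h1
  rw [integral_complex_ofReal, Complex.ofReal_inj, integral_eq_zero_iff_of_nonneg_ae
    (hpos.mono fun t ht => ht.le) hg] at h1
  obtain ⟨t, ht1, ht2⟩ := (h1.and hpos).exists
  simp only [Pi.zero_apply] at ht1
  exact ht2.ne' ht1

/-- **Szegő's limit theorem** for the determinants of Toeplitz matrices. -/
theorem tendsto_log_det_toeplitz (h : IsFourierSeq r g) (hg : Integrable g circleProb)
    (hpos : ∀ᵐ t ∂circleProb, 0 < g t) (hlog : Integrable (fun t => Real.log (g t)) circleProb) :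
    Tendsto (fun n : ℕ => (n : ℝ)⁻¹ * Real.log (toeplitz r n).det) atTop
      (𝓝 (∫ t, Real.log (g t) ∂circleProb)) := by
  have hPD := h.toeplitz_posDef hg (hpos.mono fun t => le_of_lt) (h.apply_zero_ne_zero hg hpos)
  choose x hx0 hxdet hxmin using fun n => (hPD (n + 1)).exists_min_quadratic
  -- `s n` is the ratio of the determinants of sizes `n + 1` and `n`.
  set s : ℕ → ℝ := fun n => x n ⬝ᵥ (toeplitz r (n + 1)).mulVec (x n) with hs
  set G : ℝ := Real.exp (∫ t, Real.log (g t) ∂circleProb) with hG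
  have hlow : ∀ n, G ≤ s n := by
    intro n
    simp only [hs]
    rw [h.dotProduct_toeplitz_mulVec hg]
    refine exp_integral_log_le_integral hg hpos hlog ?_
    simp only [Polynomial.finsetSum_coeff, Polynomial.coeff_monomial, Fin.val_eq_zero_iff,
      Finset.sum_ite_eq', Finset.mem_univ, if_true, hx0, Complex.ofReal_one]
  have hup : ∀ p : Polynomial ℂ, p.coeff 0 = 1 → ∀ n ≥ p.natDegree,
      s n ≤ ∫ t, ‖p.eval (circleMap 0 1 t)‖ ^ 2 * g t ∂circleProb := by
    intro p hp n hn
    have h1 := h.integral_normSq_sum hg fun i : Fin (n + 1) => p.coeff i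
    have h2 : ∀ t, ∑ i : Fin (n + 1), p.coeff i * circleMap 0 1 t ^ (i : ℕ) =
        p.eval (circleMap 0 1 t) := by
      intro t
      rw [Polynomial.eval_eq_sum_range' (Nat.lt_succ_of_le hn), Finset.sum_range]
    simp_rw [h2] at h1
    rw [h1]
    -- The real parts of the coefficients form an admissible vector; the imaginary parts only add a
    -- nonnegative term.
    have h3 := hxmin n (fun i => (p.coeff i).re) (by simp [hp])
    have h4 := (hPD (n + 1)).posSemidef.dotProduct_mulVec_nonneg
      (fun i : Fin (n + 1) => (p.coeff i).im)
    rw [star_trivial] at h4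
    simp only [hs]
    linarith
  have hslim : Tendsto s atTop (𝓝 G) := by
    rw [Metric.tendsto_atTop]
    intro ε hε
    obtain ⟨p, hp, hpG⟩ : ∃ p : Polynomial ℂ, p.coeff 0 = 1 ∧
        ∫ t, ‖p.eval (circleMap 0 1 t)‖ ^ 2 * g t ∂circleProb < G + ε := by
      by_contra! hcon
      have := le_exp_integral_log hg hpos hlog hcon
      linarith
    refine ⟨p.natDegree, fun n hn => ?_⟩
    rw [Real.dist_eq, abs_of_nonneg (sub_nonneg.2 (hlow n))]
    linarith [hup p hp n hn]
  have hG0 : 0 < G := Real.exp_pos _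
  have hs0 : ∀ n, s n ≠ 0 := fun n => (hG0.trans_le (hlow n)).ne'
  -- The ratios telescope from the empty determinant `1`, so the normalized logarithm is a Cesàro
  -- mean of `log (s k)`.
  have hsum : ∀ n, Real.log (toeplitz r n).det = ∑ k ∈ Finset.range n, Real.log (s k) := by
    intro n
    induction n with
    | zero => simp
    | succ n ih =>
      rw [Finset.sum_range_succ, ← ih, hxdet n, toeplitz_submatrix_succ,
        Real.log_mul (hPD n).det_pos.ne' (hs0 n)]
  have hloglim : Tendsto (fun n => Real.log (s n)) atTop (𝓝 (∫ t, Real.log (g t) ∂circleProb)) := by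
    have h1 := hslim.log hG0.ne'
    rwa [hG, Real.log_exp] at h1
  simp_rw [hsum]
  exact hloglim.cesaro

end IsFourierSeq

/-! ### Stationary Gaussian processes and the cross-entropy rate. -/

theorem IsStationaryCenteredGaussian.covariance_eq {Ω : Type*} [MeasurableSpace Ω]
    {X : ℕ → Ω → ℝ} {P : Measure Ω} (hX : IsStationaryCenteredGaussian X P) (i j : ℕ) :
    cov[X i, X j; P] = autocov X P (Nat.dist i j) := by
  have hle : ∀ i k : ℕ, cov[X i, X (k + i); P] = autocov X P k := by
    intro i k
    have h := hX.stationary i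
    have h1 := covariance_map_fun (μ := P) (X := fun x : ℕ → ℝ => x 0) (Y := fun x : ℕ → ℝ => x k)
      (measurable_pi_apply 0).aestronglyMeasurable (measurable_pi_apply k).aestronglyMeasurable
      h.aemeasurable_fst
    have h2 := covariance_map_fun (μ := P) (X := fun x : ℕ → ℝ => x 0) (Y := fun x : ℕ → ℝ => x k)
      (measurable_pi_apply 0).aestronglyMeasurable (measurable_pi_apply k).aestronglyMeasurable
      h.aemeasurable_snd
    rw [h.map_eq, h2] at h1
    simp only [zero_add] at h1
    exact h1.symm
  rcases le_total i j with hij | hij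
  · obtain ⟨k, rfl⟩ := Nat.exists_eq_add_of_le' hij
    rw [hle, Nat.dist_eq_sub_of_le hij, Nat.add_sub_cancel]
  · obtain ⟨k, rfl⟩ := Nat.exists_eq_add_of_le' hij
    rw [covariance_comm, hle, Nat.dist_eq_sub_of_le_right hij, Nat.add_sub_cancel]

theorem ProbabilityTheory.IsGaussianProcess.hasGaussianLaw_initialSegment {Ω : Type*} [MeasurableSpace Ω]
    {X : ℕ → Ω → ℝ} {P : Measure Ω} (hX : IsGaussianProcess X P) (n : ℕ) :
    HasGaussianLaw (initialSegment X n) P := by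
  have h := hX.hasGaussianLaw (Finset.range n)
  let L : (Finset.range n → ℝ) →L[ℝ] (Fin n → ℝ) :=
    ContinuousLinearMap.pi fun i => ContinuousLinearMap.proj ⟨(i : ℕ), Finset.mem_range.2 i.2⟩
  exact h.map_fun L

theorem lemma3 {Ω Ω' : Type*} [MeasurableSpace Ω] [MeasurableSpace Ω']
    (P : Measure Ω) (P' : Measure Ω') [IsProbabilityMeasure P] [IsProbabilityMeasure P']
    (X : ℕ → Ω → ℝ) (Y : ℕ → Ω' → ℝ)
    (hX : IsStationaryCenteredGaussian X P) (hY : IsStationaryCenteredGaussian Y P')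
    (hX0 : Var[X 0; P] ≠ 0)
    (α : ℝ) (hα0 : 0 < α) (hα1 : α ≠ 1)
    (f g h : ℝ → ℝ)
    (hf : IsPowerSpectralDensity (autocov X P) f)
    (hg : IsPowerSpectralDensity (autocov Y P') g)
    (hh : IsPowerSpectralDensity (fun k => autocov Y P' k + (α - 1) * autocov X P k) h)
    (hgpos : ∀ᵐ t ∂(volume.restrict (Set.Ioc 0 (2 * π))), 0 < g t)
    (hglog : IntervalIntegrable (fun t => Real.log (g t)) volume 0 (2 * π))
    (hhpos : ∀ᵐ t ∂(volume.restrict (Set.Ioc 0 (2 * π))), 0 < h t)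
    (hhlog : IntervalIntegrable (fun t => Real.log (h t)) volume 0 (2 * π)) :
    (∀ᵐ t ∂(volume.restrict (Set.Ioc 0 (2 * π))), h t = g t + (α - 1) * f t) ∧
    (∀ n : ℕ, HasPDF (initialSegment X n) P volume ∧ HasPDF (initialSegment Y n) P' volume) ∧
    Tendsto
      (fun n : ℕ => ((1 / (n : ℝ) : ℝ) : EReal) *
        renyiDiffCrossEntropy α (pdf (initialSegment X n) P volume)
          (pdf (initialSegment Y n) P' volume))
      atTop
      (𝓝 ((Real.log (2 * π) / 2 + 1 / (4 * π * (1 - α)) *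
        ∫ t in (0 : ℝ)..(2 * π), ((2 - α) * Real.log (g t) - Real.log (h t)) : ℝ) : EReal)) := by
  rw [← ae_circleProb_iff] at hgpos hhpos ⊢
  have hgi := hg.integrable
  have hhi := hh.integrable
  have hfi := hf.integrable
  have hgF := hg.isFourierSeq
  have hhF := hh.isFourierSeq
  have hfF := hf.isFourierSeq
  have hgl := integrable_circleProb_iff.2 hglog
  have hhl := integrable_circleProb_iff.2 hhlog
  have hdensity : ∀ᵐ t ∂circleProb, h t = g t + (α - 1) * f t := by
    have hz := ae_eq_zero_of_fourier_eq_zero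
      (w := fun t => h t - (g t + (α - 1) * f t)) (hhi.sub (hgi.add (hfi.const_mul _))) fun k => by
        have hb : ∀ {w : ℝ → ℝ}, Integrable w circleProb →
            Integrable (fun t => (w t : ℂ) * circleMap 0 1 t ^ k) circleProb := fun hw =>
          hw.ofReal.mul_bdd (c := 1) ((continuous_circleMap 0 1).pow k).aestronglyMeasurable
            (ae_of_all _ fun t => by simp)
        have he : ∀ t, ((h t - (g t + (α - 1) * f t) : ℝ) : ℂ) * circleMap 0 1 t ^ k =
            (h t : ℂ) * circleMap 0 1 t ^ k - ((g t : ℂ) * circleMap 0 1 t ^ k +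
              ((α - 1 : ℝ) : ℂ) * ((f t : ℂ) * circleMap 0 1 t ^ k)) := fun t => by
          push_cast
          ring
        simp_rw [he]
        rw [integral_sub (hb hhi) ((hb hgi).fun_add ((hb hfi).const_mul _)),
          integral_add (hb hgi) ((hb hfi).const_mul _), integral_const_mul, hhF k, hgF k, hfF k]
        push_cast
        ring
    filter_upwards [hz] with t ht
    linarith
  have hf0 : autocov X P 0 ≠ 0 := by
    rwa [autocov, covariance_self (hX.gaussian.aemeasurable 0)]
  have hf_nonneg := ae_circleProb_iff.2 hf.nonneg
  have hB : ∀ n, toeplitz (fun k => autocov Y P' k + (α - 1) * autocov X P k) n =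
      toeplitz (autocov Y P') n + (α - 1) • toeplitz (autocov X P) n := fun n => rfl
  -- The covariance of `Xⁿ` need only be positive definite, which follows from the nonzero variance;
  -- no integrability of `log f` enters.
  have hG := fun n => gaussian_renyiDiffCrossEntropy (hX.gaussian.hasGaussianLaw_initialSegment n)
    (hY.gaussian.hasGaussianLaw_initialSegment n) (fun i => hX.zero_mean i)
    (fun i => hY.zero_mean i) (S := toeplitz (autocov X P) n) (T := toeplitz (autocov Y P') n)
    (fun i j => hX.covariance_eq i j) (fun i j => hY.covariance_eq i j)
    (hfF.toeplitz_posDef hfi hf_nonneg hf0 n)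
    (hgF.toeplitz_posDef hgi (hgpos.mono fun t => le_of_lt) (hgF.apply_zero_ne_zero hgi hgpos) n)
    hα1 (by
      rw [← hB]
      exact hhF.toeplitz_posDef hhi (hhpos.mono fun t => le_of_lt)
        (hhF.apply_zero_ne_zero hhi hhpos) n)
  refine ⟨hdensity, fun n => ⟨(hG n).1, (hG n).2.1⟩, ?_⟩
  simp_rw [fun n => (hG n).2.2, ← hB, ← EReal.coe_mul]
  rw [EReal.tendsto_coe]
  have hlim := (((hgF.tendsto_log_det_toeplitz hgi hgpos hgl).const_mul (2 - α)).sub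
    (hhF.tendsto_log_det_toeplitz hhi hhpos hhl)).const_mul (1 / (2 * (1 - α)))
  have hlim' := hlim.const_add (Real.log (2 * π) / 2)
  have h1α : 1 - α ≠ 0 := sub_ne_zero.2 hα1.symm
  have hval : Real.log (2 * π) / 2 + 1 / (4 * π * (1 - α)) *
      ∫ t in (0 : ℝ)..(2 * π), ((2 - α) * Real.log (g t) - Real.log (h t)) =
      Real.log (2 * π) / 2 + 1 / (2 * (1 - α)) * ((2 - α) * ∫ t, Real.log (g t) ∂circleProb -
        ∫ t, Real.log (h t) ∂circleProb) := by
    rw [integral_circleProb, integral_circleProb,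
      intervalIntegral.integral_sub (hglog.const_mul _) hhlog, intervalIntegral.integral_const_mul,
      smul_eq_mul, smul_eq_mul]
    field_simp
    ring
  rw [hval]
  refine hlim'.congr' ?_
  -- At `n = 0` the factor `1 / n` is `0` and the constant `log (2π) / 2` is lost, so the two
  -- sequences agree only for `n ≠ 0`.
  filter_upwards [eventually_ne_atTop 0] with n hn
  have hn' : (n : ℝ) ≠ 0 := by exact_mod_cast hn
  field_simp
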